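/- **Setting.** Let $\tau,r\in\mathbb C$ with $\operatorname{Im}\tau>0$ and $\operatorname{Im}(\tau r)>0$. Put $x^{a}=e^{-\pi i a/(\tau r)}$, so that $|x|<1$, $p=x^{2r}=e^{-2\pi i/\tau}$, $z=x^{2u}$. Let $$\vartheta_1(v|t)=2P^{1/8}(P;P)_\infty\sin(\pi v)\prod_{n\ge1}(1-2P^n\cos 2\pi v+P^{2n}),\quad P=e^{2\pi i t},\ P^{1/8}=e^{2\pi i t/8},\qquad \vartheta_2(v|t)=\vartheta_1(v+\tfrac12|t),$$ $$(z;p)_\infty=\prod_{n\ge 0}(1-zp^n),\qquad (z;q,p)_\infty=\prod_{m,n\ge0}(1-zq^mp^n),\qquad \Theta_p(z)=(z;p)_\infty(p/z;p)_\infty(p;p)_\infty,$$ $$[u]=x^{u^2/r-u}\,\Theta_{x^{2r}}(x^{2u}).$$ Write $h_j(v)=\vartheta_j(v|\tau/2)$ and $h_{1,2}(v)=h_1(v)h_2(v)$. On $V=\mathbb Cv_+\oplus\mathbb Cv_-$, Baxter's $R$-matrix is, in the basis $v_+\otimes v_+,v_+\otimes v_-,v_-\otimes v_+,v_-\otimes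 v_-$, $$R(u)=R_0(u)\begin{pmatrix}a&0&0&d\\0&b&c&0\\0&c&b&0\\d&0&0&a\end{pmatrix},$$ $$R_0(u)=z^{-\frac{r-1}{2r}}\frac{(px^2z;x^4,p)_\infty(x^2z;x^4,p)_\infty(p/z;x^4,p)_\infty(x^4/z;x^4,p)_\infty}{(px^2/z;x^4,p)_\infty(x^2/z;x^4,p)_\infty(pz;x^4,p)_\infty(x^4z;x^4,p)_\infty},\qquad z^{-\frac{r-1}{2r}}=x^{-u(r-1)/r},$$ $$a=\frac{h_2(\frac1{2r})h_2(\frac u{2r})}{h_2(0)h_2(\frac{1+u}{2r})},\quad b=\frac{h_2(\frac1{2r})h_1(\frac u{2r})}{h_2(0)h_1(\frac{1+u}{2r})},\quad c=\frac{h_1(\frac1{2r})h_2(\frac u{2r})}{h_2(0)h_1(\frac{1+u}{2r})},\quad d=-\frac{h_1(\frac1{2r})h_1(\frac u{2r})}{h_2(0)h_2(\frac{1+u}{2r})}.$$ Let $P(v\otimes w)=w\otimes v$ and $\Pi=\frac12(P+\mathrm{id})$ on $V\otimes V$. Let $V^{(2)}\subset V\otimes V$ be the space of symmetric tensors, with basis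 $v^{(2)}_{2}=v_+\otimes v_+$, $v^{(2)}_0=\frac12(v_+\otimes v_-+v_-\otimes v_+)$, $v^{(2)}_{-2}=v_-\otimes v_-$. On $V_1\otimes V_2\otimes V_{\bar1}\otimes V_{\bar2}$ (four copies of $V$) put $$R^{(2,1)}_{12,\bar j}(u)=\Pi_{12}R_{1\bar j}(u+1)R_{2\bar j}(u),\qquad R^{(2,2)}(u)=\Pi_{\bar1\bar2}R^{(2,1)}_{12,\bar2}(u)R^{(2,1)}_{12,\bar1}(u-1),$$ and define the matrix elements by $R^{(2,2)}(u)\,v^{(2)}_{\mu_1}\otimes v^{(2)}_{\mu_2}=\sum_{\mu_1',\mu_2'\in\{2,0,-2\}}R^{(2,2)}(u)^{\mu_1\mu_2}_{\mu_1'\mu_2'}\,v^{(2)}_{\mu_1'}\otimes v^{(2)}_{\mu_2'}$. Let $R^{(2,1)}_0(u)=R_0(u+1)R_0(u)$ and $R^{(2,2)}_0(u)=R_0^{(2,1)}(u-1)R_0^{(2,1)}(u)$. **Proposition.** Let $u\in\mathbb C$ be such that $R(u-1)$, $R(u)$ and $R(u+1)$ are defined, that is, for $w\in\{u-1,u,u+1\}$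 neither the denominator in the formula for $R_0(w)$ nor $h_1(\frac{1+w}{2r})$ nor $h_2(\frac{1+w}{2r})$ vanishes. Then $[u-1]\ne0$ and $$R^{(2,2)}_0(u)=\frac{[u+1]}{[u-1]}.$$ The matrix elements of $R^{(2,2)}(u)$ exist and are unique. With row index $(\mu_1',\mu_2')$ and column index $(\mu_1,\mu_2)$, both ordered as $(2,2),(2,0),(2,-2),(0,2),(0,0),(0,-2),(-2,2),(-2,0),(-2,-2)$, they form the matrix $$R^{(2,2)}(u)=\frac{[u+1]}{[u-1]}\begin{pmatrix} G&0&A&0&B&0&A&0&H\\ 0&F&0&C&0&C^*&0&D&0\\ A^*&0&G^*&0&B^*&0&H^*&0&A^*\\ 0&C&0&F&0&D&0&C^*&0\\ I&0&I^*&0&E&0&I^*&0&I\\ 0&C^*&0&D&0&F&0&C&0\\ A^*&0&H^*&0&B^*&0&G^*&0&A^*\\ 0&D&0&C^*&0&C&0&F&0\\ H&0&A&0&B&0&A&0&G\end{pmatrix}.$$ To give the entries, write $f_j[k]=f_j(\frac{u+k}{2r})$ and $f_{1,2}[k]=f_1[k]f_2[k]$ for functions $f_1,f_2$. The entries without a star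 are the following expressions with $(f_1,f_2)=(h_1,h_2)$. The starred entries are the same expressions with $(f_1,f_2)=(-h_2,h_1)$. $$A=-\frac{h_1(\frac1r)f_2[0]h_{1,2}(\frac1{2r})f_{1,2}[0]}{h_2(0)^3f_2[2]f_{1,2}[1]},\qquad B=-\frac{h_2(\frac1r)f_1[0]h_{1,2}(\frac1{2r})f_{1,2}[0]}{h_2(0)^3f_2[2]f_{1,2}[1]},$$ $$C=\frac{f_2[0]^2h_{1,2}(\frac1r)}{h_2(0)^2f_{1,2}[2]},\qquad D=-\frac{h_1(\frac1r)^2f_{1,2}[0]}{h_2(0)^2f_{1,2}[2]},\qquad F=\frac{h_2(\frac1r)^2f_{1,2}[0]}{h_2(0)^2f_{1,2}[2]},$$ $$E=\frac{h_1(\frac1r)h_{1,2}(\frac1{2r})\left(f_2[1]^3f_2[-1]+f_1[1]^3f_1[-1]\right)}{h_2(0)^3f_{1,2}[2]f_{1,2}[1]}+\frac{h_2(\frac1r)^2f_{1,2}[0]}{h_2(0)^2f_{1,2}[2]},$$ $$G=\frac{f_2[0]\left(h_1(\frac1{2r})^4f_1[-1]f_2[1]+h_2(\frac1{2r})^4f_2[-1]f_1[1]\right)}{h_2(0)^4f_2[2]f_{1,2}[1]},\qquad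 H=\frac{h_1(\frac1r)f_1[0]^3h_{1,2}(\frac1{2r})}{h_2(0)^3f_2[2]f_{1,2}[1]},$$ $$I=-\frac{h_1(\frac1r)\left(h_2(\frac1{2r})^2f_1[1]^3f_2[-1]+h_1(\frac1{2r})^2f_2[1]^3f_1[-1]\right)}{h_2(0)^3f_{1,2}[2]f_{1,2}[1]}-\frac{f_1[0]^2h_{1,2}(\frac1r)}{h_2(0)^2f_{1,2}[2]}.$$ Moreover, for all $\mu_1,\mu_2,\mu_1',\mu_2'\in\{2,0,-2\}$, $$R^{(2,2)}(u)^{\mu_1\mu_2}_{\mu_1'\mu_2'}=R^{(2,2)}(u)^{\mu_2\mu_1}_{\mu_2'\mu_1'}\quad(P\text{-invariance}),\qquad R^{(2,2)}(u)^{\mu_1\mu_2}_{\mu_1'\mu_2'}=R^{(2,2)}(u)^{-\mu_1,-\mu_2}_{-\mu_1',-\mu_2'}\quad(\mathbb Z_2\text{-symmetry}).$$ -/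

import Mathlib

open Complex

noncomputable section

/-! ## Theta functions -/

/-- `ϑ₁(v|t) = 2 P^{1/8} (P;P)_∞ sin(πv) ∏_{n ≥ 1} (1 - 2 Pⁿ cos(2πv) + P²ⁿ)`, `P = e^{2πit}`. -/
def theta1 (v t : ℂ) : ℂ :=
  2 * exp (2 * Real.pi * I * t / 8) * (∏' n : ℕ, (1 - exp (2 * Real.pi * I * t) ^ (n + 1)))
    * sin (Real.pi * v)
    * ∏' n : ℕ, (1 - 2 * exp (2 * Real.pi * I * t) ^ (n + 1) * cos (2 * Real.pi * v)
        + exp (2 * Real.pi * I * t) ^ (2 * (n + 1)))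

/-- `ϑ₂(v|t) = ϑ₁(v + 1/2|t)`. -/
def theta2 (v t : ℂ) : ℂ := theta1 (v + 1 / 2) t

/-! ## The nome, infinite products and the symbol `[u]` -/

/-- `p = e^{-2πi/τ}`. -/
def nomeP (τ : ℂ) : ℂ := exp (-(2 * Real.pi * I) / τ)

/-- `xPow τ r a = x^a`, with the branch `x^a = e^{-πia/(τr)}`, so that `p = x^{2r}`. -/
def xPow (τ r a : ℂ) : ℂ := exp (-(Real.pi * I * a) / (τ * r))

/-- `(z; p)_∞ = ∏_{n ≥ 0} (1 - z pⁿ)`. -/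
def qPoch (z p : ℂ) : ℂ := ∏' n : ℕ, (1 - z * p ^ n)

/-- `(z; q, p)_∞ = ∏_{m,n ≥ 0} (1 - z q^m pⁿ)`. -/
def qPoch₂ (z q p : ℂ) : ℂ := ∏' k : ℕ × ℕ, (1 - z * q ^ k.1 * p ^ k.2)

/-- `Θ_p(z) = (z; p)_∞ (p/z; p)_∞ (p; p)_∞`. -/
def bigTheta (p z : ℂ) : ℂ := qPoch z p * qPoch (p / z) p * qPoch p p

/-- `[u] = x^{u²/r - u} Θ_{x^{2r}}(x^{2u})`. -/
def bracket (τ r u : ℂ) : ℂ :=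
  xPow τ r (u ^ 2 / r - u) * bigTheta (xPow τ r (2 * r)) (xPow τ r (2 * u))

/-! ## Baxter's elliptic `R`-matrix -/

/-- The numerator of the infinite-product part of `R₀(u)`; here `z = x^{2u}`. -/
def baxterR0Num (τ r u : ℂ) : ℂ :=
  let p := nomeP τ
  let q := xPow τ r 4
  let z := xPow τ r (2 * u)
  qPoch₂ (p * xPow τ r 2 * z) q p * qPoch₂ (xPow τ r 2 * z) q p
    * qPoch₂ (p / z) q p * qPoch₂ (xPow τ r 4 / z) q p

/-- The denominator of the infinite-product part of `R₀(u)`; here `z = x^{2u}`. -/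
def baxterR0Den (τ r u : ℂ) : ℂ :=
  let p := nomeP τ
  let q := xPow τ r 4
  let z := xPow τ r (2 * u)
  qPoch₂ (p * xPow τ r 2 / z) q p * qPoch₂ (xPow τ r 2 / z) q p
    * qPoch₂ (p * z) q p * qPoch₂ (xPow τ r 4 * z) q p

/-- `R₀(u)`; the factor `z^{-(r-1)/(2r)}` is `x^{-u(r-1)/r}`. -/
def baxterR0 (τ r u : ℂ) : ℂ :=
  xPow τ r (-(u * (r - 1) / r)) * (baxterR0Num τ r u / baxterR0Den τ r u)

/-- `a(u)`. -/
def weightA (τ r u : ℂ) : ℂ :=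
  theta2 (1 / (2 * r)) (τ / 2) * theta2 (u / (2 * r)) (τ / 2)
    / (theta2 0 (τ / 2) * theta2 ((1 + u) / (2 * r)) (τ / 2))

/-- `b(u)`. -/
def weightB (τ r u : ℂ) : ℂ :=
  theta2 (1 / (2 * r)) (τ / 2) * theta1 (u / (2 * r)) (τ / 2)
    / (theta2 0 (τ / 2) * theta1 ((1 + u) / (2 * r)) (τ / 2))

/-- `c(u)`. -/
def weightC (τ r u : ℂ) : ℂ :=
  theta1 (1 / (2 * r)) (τ / 2) * theta2 (u / (2 * r)) (τ / 2)
    / (theta2 0 (τ / 2) * theta1 ((1 + u) / (2 * r)) (τ / 2))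

/-- `d(u)`. -/
def weightD (τ r u : ℂ) : ℂ :=
  -(theta1 (1 / (2 * r)) (τ / 2) * theta1 (u / (2 * r)) (τ / 2)
    / (theta2 0 (τ / 2) * theta2 ((1 + u) / (2 * r)) (τ / 2)))

/-- Baxter's `R(u)` on `V ⊗ V`, in the basis `v₊⊗v₊, v₊⊗v₋, v₋⊗v₊, v₋⊗v₋`; the index
`0 : Fin 2` stands for `+` and `1 : Fin 2` for `-`. Rows are outputs, columns are inputs. -/
def baxterR (τ r u : ℂ) : Matrix (Fin 2 × Fin 2) (Fin 2 × Fin 2) ℂ :=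
  baxterR0 τ r u •
    (!![weightA τ r u, 0, 0, weightD τ r u;
        0, weightB τ r u, weightC τ r u, 0;
        0, weightC τ r u, weightB τ r u, 0;
        weightD τ r u, 0, 0, weightA τ r u] : Matrix (Fin (2 * 2)) (Fin (2 * 2)) ℂ).submatrix
      finProdFinEquiv finProdFinEquiv

/-- `R(u)` is defined at `u`: none of the denominators in its formula that depend on `u`
vanishes. -/
def BaxterRegular (τ r u : ℂ) : Prop :=
  baxterR0Den τ r u ≠ 0 ∧ theta1 ((1 + u) / (2 * r)) (τ / 2) ≠ 0 ∧
    theta2 ((1 + u) / (2 * r)) (τ / 2) ≠ 0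

/-! ## Fusion -/

/-- The four tensor factors are `V₁, V₂, V₁', V₂'` (positions `0, 1, 2, 3`, a prime standing for
a bar), and `V₁⊗V₂⊗V₁'⊗V₂'` is identified with the functions on `Fin 4 → Fin 2`. For `i ≠ j`,
`onLegs A i j` acts as `A` on the factors at positions `i` (first) and `j` (second) and as the
identity on the two others. -/
def onLegs (A : Matrix (Fin 2 × Fin 2) (Fin 2 × Fin 2) ℂ) (i j : Fin 4) :
    Matrix (Fin 4 → Fin 2) (Fin 4 → Fin 2) ℂ :=
  Matrix.of fun s t => if ∀ k, k ≠ i → k ≠ j → s k = t k then A (s i, s j) (t i, t j) else 0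

/-- The permutation `P` of the two factors of `V ⊗ V`. -/
def permP : Matrix (Fin 2 × Fin 2) (Fin 2 × Fin 2) ℂ :=
  Matrix.of fun s t => if s = t.swap then 1 else 0

/-- The projection `Π = (P + id)/2` on the symmetric tensors. -/
def symProj : Matrix (Fin 2 × Fin 2) (Fin 2 × Fin 2) ℂ := (1 / 2 : ℂ) • (permP + 1)

/-- `R^{(2,1)}_{12,j}(u) = Π₁₂ R_{1j}(u+1) R_{2j}(u)`, acting on the four factors
(`j = 2` is `V₁'`, `j = 3` is `V₂'`). -/
def fusedR21 (τ r : ℂ) (j : Fin 4) (u : ℂ) : Matrix (Fin 4 → Fin 2) (Fin 4 → Fin 2) ℂ :=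
  onLegs symProj 0 1 * onLegs (baxterR τ r (u + 1)) 0 j * onLegs (baxterR τ r u) 1 j

/-- `R^{(2,2)}(u) = Π_{1'2'} R^{(2,1)}_{12,2'}(u) R^{(2,1)}_{12,1'}(u-1)`. -/
def fusedR22 (τ r u : ℂ) : Matrix (Fin 4 → Fin 2) (Fin 4 → Fin 2) ℂ :=
  onLegs symProj 2 3 * fusedR21 τ r 3 u * fusedR21 τ r 2 (u - 1)

/-- The basis `v⁽²⁾_μ` of `V⁽²⁾`, with `0, 1, 2 : Fin 3` standing for `μ = 2, 0, -2`:
`v₊⊗v₊`, `(v₊⊗v₋ + v₋⊗v₊)/2`, `v₋⊗v₋`, given by components. -/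
def symVec (μ : Fin 3) (a b : Fin 2) : ℂ :=
  (![!![1, 0; 0, 0], !![0, 1 / 2; 1 / 2, 0], !![0, 0; 0, 1]] :
    Fin 3 → Matrix (Fin 2) (Fin 2) ℂ) μ a b

/-- `v⁽²⁾_{μ₁} ⊗ v⁽²⁾_{μ₂}` in `V₁⊗V₂⊗V₁'⊗V₂'`. -/
def symVec₂ (μ : Fin 3 × Fin 3) : (Fin 4 → Fin 2) → ℂ :=
  fun s => symVec μ.1 (s 0) (s 1) * symVec μ.2 (s 2) (s 3)

/-- `M` is the array of matrix elements of `T` on `V⁽²⁾ ⊗ V⁽²⁾`: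
`T v_{μ₁}⊗v_{μ₂} = ∑ T^{μ₁ μ₂}_{ν₁ ν₂} v_{ν₁}⊗v_{ν₂}` with `T^{μ₁ μ₂}_{ν₁ ν₂}` the entry of `M`
in row `(ν₁, ν₂)` and column `(μ₁, μ₂)`. -/
def IsFusedMatrix (T : Matrix (Fin 4 → Fin 2) (Fin 4 → Fin 2) ℂ)
    (M : Matrix (Fin 3 × Fin 3) (Fin 3 × Fin 3) ℂ) : Prop :=
  ∀ μ : Fin 3 × Fin 3, T.mulVec (symVec₂ μ) = ∑ ν : Fin 3 × Fin 3, M ν μ • symVec₂ ν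

/-- `R₀^{(2,1)}(u) = R₀(u+1) R₀(u)`. -/
def fusedR21Pref (τ r u : ℂ) : ℂ := baxterR0 τ r (u + 1) * baxterR0 τ r u

/-- `R₀^{(2,2)}(u) = R₀^{(2,1)}(u-1) R₀^{(2,1)}(u)`. -/
def fusedR22Pref (τ r u : ℂ) : ℂ := fusedR21Pref τ r (u - 1) * fusedR21Pref τ r u

/-! ## The explicit entries

`h₁ = ϑ₁(·|τ/2)` and `h₂ = ϑ₂(·|τ/2)` stand in the factors that do not depend on `u`, and
`f₁`, `f₂` in those that do. The plain entries have `f₁ = h₁`, `f₂ = h₂`; the starred entries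
have `f₁ = -h₂`, `f₂ = h₁`. -/

/-- `A`. -/
def entryA (h₁ h₂ : ℂ → ℂ) (r u : ℂ) (f₁ f₂ : ℂ → ℂ) : ℂ :=
  -(h₁ (1 / r) * f₂ (u / (2 * r)) * (h₁ (1 / (2 * r)) * h₂ (1 / (2 * r)))
      * (f₁ (u / (2 * r)) * f₂ (u / (2 * r)))
    / (h₂ 0 ^ 3 * f₂ ((u + 2) / (2 * r)) * (f₁ ((u + 1) / (2 * r)) * f₂ ((u + 1) / (2 * r)))))

/-- `B`. -/
def entryB (h₁ h₂ : ℂ → ℂ) (r u : ℂ) (f₁ f₂ : ℂ → ℂ) : ℂ :=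
  -(h₂ (1 / r) * f₁ (u / (2 * r)) * (h₁ (1 / (2 * r)) * h₂ (1 / (2 * r)))
      * (f₁ (u / (2 * r)) * f₂ (u / (2 * r)))
    / (h₂ 0 ^ 3 * f₂ ((u + 2) / (2 * r)) * (f₁ ((u + 1) / (2 * r)) * f₂ ((u + 1) / (2 * r)))))

/-- `C`. -/
def entryC (h₁ h₂ : ℂ → ℂ) (r u : ℂ) (f₁ f₂ : ℂ → ℂ) : ℂ :=
  f₂ (u / (2 * r)) ^ 2 * (h₁ (1 / r) * h₂ (1 / r))
    / (h₂ 0 ^ 2 * (f₁ ((u + 2) / (2 * r)) * f₂ ((u + 2) / (2 * r))))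

/-- `D`. -/
def entryD (h₁ h₂ : ℂ → ℂ) (r u : ℂ) (f₁ f₂ : ℂ → ℂ) : ℂ :=
  -(h₁ (1 / r) ^ 2 * (f₁ (u / (2 * r)) * f₂ (u / (2 * r)))
    / (h₂ 0 ^ 2 * (f₁ ((u + 2) / (2 * r)) * f₂ ((u + 2) / (2 * r)))))

/-- `E`. -/
def entryE (h₁ h₂ : ℂ → ℂ) (r u : ℂ) (f₁ f₂ : ℂ → ℂ) : ℂ :=
  h₁ (1 / r) * (h₁ (1 / (2 * r)) * h₂ (1 / (2 * r)))
      * (f₂ ((u + 1) / (2 * r)) ^ 3 * f₂ ((u - 1) / (2 * r))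
        + f₁ ((u + 1) / (2 * r)) ^ 3 * f₁ ((u - 1) / (2 * r)))
    / (h₂ 0 ^ 3 * (f₁ ((u + 2) / (2 * r)) * f₂ ((u + 2) / (2 * r)))
      * (f₁ ((u + 1) / (2 * r)) * f₂ ((u + 1) / (2 * r))))
  + h₂ (1 / r) ^ 2 * (f₁ (u / (2 * r)) * f₂ (u / (2 * r)))
    / (h₂ 0 ^ 2 * (f₁ ((u + 2) / (2 * r)) * f₂ ((u + 2) / (2 * r))))

/-- `F`. -/
def entryF (_h₁ h₂ : ℂ → ℂ) (r u : ℂ) (f₁ f₂ : ℂ → ℂ) : ℂ :=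
  h₂ (1 / r) ^ 2 * (f₁ (u / (2 * r)) * f₂ (u / (2 * r)))
    / (h₂ 0 ^ 2 * (f₁ ((u + 2) / (2 * r)) * f₂ ((u + 2) / (2 * r))))

/-- `G`. -/
def entryG (h₁ h₂ : ℂ → ℂ) (r u : ℂ) (f₁ f₂ : ℂ → ℂ) : ℂ :=
  f₂ (u / (2 * r))
      * (h₁ (1 / (2 * r)) ^ 4 * f₁ ((u - 1) / (2 * r)) * f₂ ((u + 1) / (2 * r))
        + h₂ (1 / (2 * r)) ^ 4 * f₂ ((u - 1) / (2 * r)) * f₁ ((u + 1) / (2 * r)))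
    / (h₂ 0 ^ 4 * f₂ ((u + 2) / (2 * r)) * (f₁ ((u + 1) / (2 * r)) * f₂ ((u + 1) / (2 * r))))

/-- `H`. -/
def entryH (h₁ h₂ : ℂ → ℂ) (r u : ℂ) (f₁ f₂ : ℂ → ℂ) : ℂ :=
  h₁ (1 / r) * f₁ (u / (2 * r)) ^ 3 * (h₁ (1 / (2 * r)) * h₂ (1 / (2 * r)))
    / (h₂ 0 ^ 3 * f₂ ((u + 2) / (2 * r)) * (f₁ ((u + 1) / (2 * r)) * f₂ ((u + 1) / (2 * r))))

/-- `I`. -/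
def entryI (h₁ h₂ : ℂ → ℂ) (r u : ℂ) (f₁ f₂ : ℂ → ℂ) : ℂ :=
  -(h₁ (1 / r)
      * (h₂ (1 / (2 * r)) ^ 2 * f₁ ((u + 1) / (2 * r)) ^ 3 * f₂ ((u - 1) / (2 * r))
        + h₁ (1 / (2 * r)) ^ 2 * f₂ ((u + 1) / (2 * r)) ^ 3 * f₁ ((u - 1) / (2 * r)))
    / (h₂ 0 ^ 3 * (f₁ ((u + 2) / (2 * r)) * f₂ ((u + 2) / (2 * r)))
      * (f₁ ((u + 1) / (2 * r)) * f₂ ((u + 1) / (2 * r)))))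
  - f₁ (u / (2 * r)) ^ 2 * (h₁ (1 / r) * h₂ (1 / r))
    / (h₂ 0 ^ 2 * (f₁ ((u + 2) / (2 * r)) * f₂ ((u + 2) / (2 * r))))

/-- The explicit `9 × 9` matrix, in the basis `v_{μ₁}⊗v_{μ₂}` ordered lexicographically with
`μ = 2, 0, -2`. -/
def explicitMatrix (τ r u : ℂ) : Matrix (Fin 3 × Fin 3) (Fin 3 × Fin 3) ℂ :=
  let h₁ : ℂ → ℂ := fun v => theta1 v (τ / 2)
  let h₂ : ℂ → ℂ := fun v => theta2 v (τ / 2)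
  let A := entryA h₁ h₂ r u h₁ h₂
  let B := entryB h₁ h₂ r u h₁ h₂
  let C := entryC h₁ h₂ r u h₁ h₂
  let D := entryD h₁ h₂ r u h₁ h₂
  let E := entryE h₁ h₂ r u h₁ h₂
  let F := entryF h₁ h₂ r u h₁ h₂
  let G := entryG h₁ h₂ r u h₁ h₂
  let H := entryH h₁ h₂ r u h₁ h₂
  let J := entryI h₁ h₂ r u h₁ h₂
  let As := entryA h₁ h₂ r u (-h₂) h₁
  let Bs := entryB h₁ h₂ r u (-h₂) h₁
  let Cs := entryC h₁ h₂ r u (-h₂) h₁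
  let Gs := entryG h₁ h₂ r u (-h₂) h₁
  let Hs := entryH h₁ h₂ r u (-h₂) h₁
  let Js := entryI h₁ h₂ r u (-h₂) h₁
  (!![G,  0,  A,  0,  B,  0,  A,  0,  H;
      0,  F,  0,  C,  0,  Cs, 0,  D,  0;
      As, 0,  Gs, 0,  Bs, 0,  Hs, 0,  As;
      0,  C,  0,  F,  0,  D,  0,  Cs, 0;
      J,  0,  Js, 0,  E,  0,  Js, 0,  J;
      0,  Cs, 0,  D,  0,  F,  0,  C,  0;
      As, 0,  Hs, 0,  Bs, 0,  Gs, 0,  As;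
      0,  D,  0,  Cs, 0,  C,  0,  F,  0;
      H,  0,  A,  0,  B,  0,  A,  0,  G] : Matrix (Fin (3 * 3)) (Fin (3 * 3)) ℂ).submatrix
    finProdFinEquiv finProdFinEquiv

end

open Complex

/-! ## Infinite products -/

/-! The scalar prefactor and the matrix part of the fused operator are treated separately. For the
prefactor, raising `u` by 1 multiplies `z` by `x²`, while the double products have base `x⁴`. Hence
in `R₀(u+1)R₀(u)` they telescope to single products (`r0_fusion`). Combining the results at `u` and
`u-1` leaves a quotient of two theta functions times a power of `x` (`bracket_quotient`), which is
`[u+1]/[u-1]`. Regularity of the three `R`-matrices excludes a zero of `[u-1]`. For the matrix part,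
put `v = u/(2r)`, `η = 1/(2r)`. Everything follows from three identities among the values of `ϑ₁`,
`ϑ₂` at `v-η`, `v`, `v+η` (`ThetaRelations`), taken at `v` and at `v+η`. They make `Π₁₂R_{1j}R_{2j}`
vanish on antisymmetric tensors, so its action on `v⁽²⁾_0` may be computed on `v₊⊗v₋` alone; the
fused weights then collapse to the monomials of `thetaWeights`. The same identities give the
relations for the second fusion (`DoubleFusionRelations`), after which each of the 81 entries is a
short polynomial in fused weights. Uniqueness of the matrix elements is linear independence of the
vectors `v⁽²⁾_{μ₁}⊗v⁽²⁾_{μ₂}`, and the two symmetries are visible in the pattern of `nineMatrix`.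
The theta identities come from the Jacobi triple product, which turns `ϑ₁` into a series: a product
of two such series, reindexed by sums and differences of indices, is bilinear in two theta series of
parameter `2t`, and the addition formulas become linear algebra. The substitution `(f₁,f₂) =
(-h₂,h₁)` behind the starred entries is the half-period shift of `v` to `v - 1/2`. -/

theorem summable_norm_mul_pow (z : ℂ) {p : ℂ} (hp : ‖p‖ < 1) :
    Summable fun n : ℕ => ‖-(z * p ^ n)‖ := by
  simpa [norm_mul, norm_pow] using
    (summable_geometric_of_lt_one (norm_nonneg p) hp).mul_left ‖z‖

theorem summable_norm_mul_pow_mul_pow (z : ℂ) {q p : ℂ} (hq : ‖q‖ < 1) (hp : ‖p‖ < 1) :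
    Summable fun k : ℕ × ℕ => ‖-(z * q ^ k.1 * p ^ k.2)‖ := by
  have h := ((summable_geometric_of_lt_one (norm_nonneg q) hq).mul_of_nonneg
    (summable_geometric_of_lt_one (norm_nonneg p) hp)
    (fun _ => by positivity) (fun _ => by positivity)).mul_left ‖z‖
  simpa [norm_mul, norm_pow, mul_assoc] using h

theorem multipliable_qPoch (z : ℂ) {p : ℂ} (hp : ‖p‖ < 1) :
    Multipliable fun n : ℕ => 1 - z * p ^ n := by
  simpa [sub_eq_add_neg] using multipliable_one_add_of_summable (summable_norm_mul_pow z hp)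

theorem multipliable_qPoch₂ (z : ℂ) {q p : ℂ} (hq : ‖q‖ < 1) (hp : ‖p‖ < 1) :
    Multipliable fun k : ℕ × ℕ => 1 - z * q ^ k.1 * p ^ k.2 := by
  simpa [sub_eq_add_neg] using
    multipliable_one_add_of_summable (summable_norm_mul_pow_mul_pow z hq hp)

theorem qPoch_ne_zero {z p : ℂ} (hp : ‖p‖ < 1) (h : ∀ n : ℕ, z * p ^ n ≠ 1) :
    qPoch z p ≠ 0 := by
  have := tprod_one_add_ne_zero_of_summable (f := fun n : ℕ => -(z * p ^ n))
    (fun n => by rw [← sub_eq_add_neg, sub_ne_zero]; exact (h n).symm)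
    (summable_norm_mul_pow z hp)
  simpa [qPoch, sub_eq_add_neg] using this

theorem qPoch_self_ne_zero {p : ℂ} (hp : ‖p‖ < 1) : qPoch p p ≠ 0 := by
  refine qPoch_ne_zero hp fun n h => ?_
  have h1 : ‖p ^ (n + 1)‖ < 1 := by
    rw [norm_pow]
    exact pow_lt_one₀ (norm_nonneg p) hp n.succ_ne_zero
  rw [pow_succ', h] at h1
  simp at h1

theorem qPoch_eq_mul (z : ℂ) {p : ℂ} (hp : ‖p‖ < 1) :
    qPoch z p = (1 - z) * qPoch (p * z) p := by
  have e : (fun n : ℕ => 1 - z * p ^ (n + 1)) = fun n : ℕ => 1 - p * z * p ^ n := by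
    funext n
    ring
  have h : Multipliable fun n : ℕ => 1 - z * p ^ (n + 1) := e ▸ multipliable_qPoch (p * z) hp
  have h' := tprod_eq_zero_mul' (f := fun n : ℕ => 1 - z * p ^ n) h
  rw [e] at h'
  rw [qPoch, qPoch, h', pow_zero, mul_one]

theorem qPoch₂_eq_tprod (z : ℂ) {q p : ℂ} (hq : ‖q‖ < 1) (hp : ‖p‖ < 1) :
    qPoch₂ z q p = ∏' k : ℕ, qPoch (z * q ^ k) p :=
  (multipliable_qPoch₂ z hq hp).tprod_prod' fun k => multipliable_qPoch (z * q ^ k) hp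

theorem multipliable_qPoch_mul_pow (z : ℂ) {q p : ℂ} (hq : ‖q‖ < 1) (hp : ‖p‖ < 1) :
    Multipliable fun k : ℕ => qPoch (z * q ^ k) p :=
  ((multipliable_qPoch₂ z hq hp).hasProd.prod_fiberwise
    fun k => (multipliable_qPoch (z * q ^ k) hp).hasProd).multipliable

theorem qPoch₂_eq_mul (z : ℂ) {q p : ℂ} (hq : ‖q‖ < 1) (hp : ‖p‖ < 1) :
    qPoch₂ z q p = qPoch z p * qPoch₂ (q * z) q p := by
  have e : (fun n : ℕ => qPoch (z * q ^ (n + 1)) p) = fun n : ℕ => qPoch (q * z * q ^ n) p := by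
    funext n
    rw [pow_succ', mul_comm q z, mul_assoc]
  have h : Multipliable fun n : ℕ => qPoch (z * q ^ (n + 1)) p :=
    e ▸ multipliable_qPoch_mul_pow (q * z) hq hp
  have h' := tprod_eq_zero_mul' (f := fun n : ℕ => qPoch (z * q ^ n) p) h
  rw [e] at h'
  rw [qPoch₂_eq_tprod z hq hp, qPoch₂_eq_tprod (q * z) hq hp, h', pow_zero, mul_one]

/-! ## The scalar factor -/

theorem xPow_add (τ r a b : ℂ) : xPow τ r (a + b) = xPow τ r a * xPow τ r b := by
  rw [xPow, xPow, xPow, ← exp_add]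
  congr 1
  ring

theorem xPow_ne_zero (τ r a : ℂ) : xPow τ r a ≠ 0 := exp_ne_zero _

theorem norm_exp_neg_div_lt_one {c : ℝ} (hc : 0 < c) {s : ℂ} (hs : 0 < s.im) :
    ‖exp (-(c * I) / s)‖ < 1 := by
  rw [norm_exp, Real.exp_lt_one_iff]
  have hs0 : 0 < normSq s := normSq_pos.mpr fun h => by simp [h] at hs
  have : (-(c * I) / s).re = -(c * s.im / normSq s) := by
    simp [div_re]
    ring
  rw [this]
  exact neg_neg_of_pos (by positivity)

theorem norm_nomeP_lt_one {τ : ℂ} (hτ : 0 < τ.im) : ‖nomeP τ‖ < 1 := by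
  have := norm_exp_neg_div_lt_one Real.two_pi_pos hτ
  simpa [nomeP] using this

theorem norm_xPow_four_lt_one {τ r : ℂ} (hr : 0 < (τ * r).im) : ‖xPow τ r 4‖ < 1 := by
  have := norm_exp_neg_div_lt_one (c := Real.pi * 4) (by positivity) hr
  rw [xPow]
  convert this using 5
  push_cast
  ring

theorem xPow_two_mul_self {τ r : ℂ} (hr : r ≠ 0) : xPow τ r (2 * r) = nomeP τ := by
  rw [xPow, nomeP]
  congr 1
  rw [neg_div, neg_div, show (Real.pi : ℂ) * I * (2 * r) = 2 * Real.pi * I * r by ring,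
    mul_div_mul_right _ _ hr]

/-- The product part of `R₀(u)` as a function of `p, x, z`: the numerator. -/
noncomputable def r0Num (p x z : ℂ) : ℂ :=
  qPoch₂ (p * x ^ 2 * z) (x ^ 4) p * qPoch₂ (x ^ 2 * z) (x ^ 4) p
    * qPoch₂ (p / z) (x ^ 4) p * qPoch₂ (x ^ 4 / z) (x ^ 4) p

/-- The product part of `R₀(u)` as a function of `p, x, z`: the denominator. -/
noncomputable def r0Den (p x z : ℂ) : ℂ :=
  qPoch₂ (p * x ^ 2 / z) (x ^ 4) p * qPoch₂ (x ^ 2 / z) (x ^ 4) p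
    * qPoch₂ (p * z) (x ^ 4) p * qPoch₂ (x ^ 4 * z) (x ^ 4) p

/-- After cancellation there remain four quotients of `(x⁴w; x⁴, p)_∞` and `(w; x⁴, p)_∞`, with `w =
x²z`, `p/(x²z)`, `1/z`, `pz`, and each is a single product or its inverse. The nonvanishing of the
two denominators licenses the cancellation and also gives the nonvanishing of the single products
left below. -/
theorem r0_fusion {p x z : ℂ} (hx : x ≠ 0) (hz : z ≠ 0) (hp : ‖p‖ < 1) (hq : ‖x ^ 4‖ < 1)
    (h0 : r0Den p x z ≠ 0) (h1 : r0Den p x (x ^ 2 * z) ≠ 0) :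
    qPoch (1 / z) p ≠ 0 ∧ qPoch (p * z) p ≠ 0 ∧
    r0Num p x (x ^ 2 * z) / r0Den p x (x ^ 2 * z) * (r0Num p x z / r0Den p x z) =
      qPoch (x ^ 2 * z) p * qPoch (p / (x ^ 2 * z)) p / (qPoch (1 / z) p * qPoch (p * z) p) := by
  have e1 := qPoch₂_eq_mul (x ^ 2 * z) hq hp
  have e2 := qPoch₂_eq_mul (1 / z) hq hp
  have e3 := qPoch₂_eq_mul (p * z) hq hp
  have e4 := qPoch₂_eq_mul (p / (x ^ 2 * z)) hq hp
  have a1 : p * x ^ 2 * (x ^ 2 * z) = x ^ 4 * (p * z) := by ring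
  have a2 : x ^ 2 * (x ^ 2 * z) = x ^ 4 * z := by ring
  have a3 : x ^ 4 / (x ^ 2 * z) = x ^ 2 / z := by field_simp
  have a4 : p * x ^ 2 / (x ^ 2 * z) = p / z := by field_simp
  have a5 : x ^ 2 / (x ^ 2 * z) = 1 / z := by field_simp
  have a6 : p * (x ^ 2 * z) = p * x ^ 2 * z := by ring
  have a7 : x ^ 4 * (p / (x ^ 2 * z)) = p * x ^ 2 / z := by field_simp
  have a8 : x ^ 4 * (1 / z) = x ^ 4 / z := by ring
  rw [a7] at e4
  rw [a8] at e2
  simp only [r0Den, r0Num, a1, a2, a3, a4, a5, a6] at h0 h1 ⊢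
  rw [e3] at h0
  rw [e2] at h1
  simp only [mul_ne_zero_iff] at h0 h1
  obtain ⟨⟨⟨h01, h02⟩, h03, h03'⟩, h04⟩ := h0
  obtain ⟨⟨⟨h11, h12, h12'⟩, h13⟩, h14⟩ := h1
  refine ⟨h12, h03, ?_⟩
  rw [e1, e2, e3, e4]
  generalize qPoch₂ (x ^ 4 * (p * z)) (x ^ 4) p = w1 at *
  generalize qPoch₂ (p * x ^ 2 / z) (x ^ 4) p = w2 at *
  generalize qPoch₂ (p * x ^ 2 * z) (x ^ 4) p = w3 at *
  generalize qPoch₂ (x ^ 4 * (x ^ 2 * z)) (x ^ 4) p = w4 at *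
  generalize qPoch (1 / z) p = w5 at *
  generalize qPoch (p * z) p = w6 at *
  generalize qPoch (p / (x ^ 2 * z)) p = w7 at *
  field_simp

theorem baxterR0_eq (τ r u : ℂ) :
    baxterR0 τ r u = xPow τ r (-(u * (r - 1) / r)) *
      (r0Num (nomeP τ) (xPow τ r 1) (xPow τ r (2 * u)) /
        r0Den (nomeP τ) (xPow τ r 1) (xPow τ r (2 * u))) ∧
    baxterR0Den τ r u = r0Den (nomeP τ) (xPow τ r 1) (xPow τ r (2 * u)) := by
  have h2 : xPow τ r 2 = xPow τ r 1 ^ 2 := by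
    rw [pow_two, ← xPow_add]
    norm_num
  have h4 : xPow τ r 4 = xPow τ r 1 ^ 4 := by
    rw [show xPow τ r 1 ^ 4 = xPow τ r 1 ^ 2 * xPow τ r 1 ^ 2 by ring, ← h2, ← xPow_add]
    norm_num
  simp only [baxterR0, baxterR0Num, baxterR0Den, r0Num, r0Den, h2, h4, and_self]

/-- The single products pair up into theta functions once `1 - z` is replaced by `-z(1 - 1/z)`, and
likewise for `z/x²`. The two monomials `-z` and `-z/x²` so released multiply to `z²/x²`. -/
theorem bracket_quotient {p x z : ℂ} (hx : x ≠ 0) (hz : z ≠ 0) (hp : ‖p‖ < 1)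
    (h1 : qPoch (1 / z) p ≠ 0) (h2 : qPoch (p * z) p ≠ 0)
    (h3 : qPoch (x ^ 2 / z) p ≠ 0) (h4 : qPoch (p * z / x ^ 2) p ≠ 0) :
    bigTheta p (z / x ^ 2) ≠ 0 ∧
    qPoch z p * qPoch (p / z) p / (qPoch (x ^ 2 / z) p * qPoch (p * z / x ^ 2) p) *
      (qPoch (x ^ 2 * z) p * qPoch (p / (x ^ 2 * z)) p / (qPoch (1 / z) p * qPoch (p * z) p)) =
    z * z / x ^ 2 * (bigTheta p (x ^ 2 * z) / bigTheta p (z / x ^ 2)) := by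
  have e1 := qPoch_eq_mul (1 / z) hp
  have e2 := qPoch_eq_mul z hp
  have e3 := qPoch_eq_mul (x ^ 2 / z) hp
  have e4 := qPoch_eq_mul (z / x ^ 2) hp
  have a1 : p * (1 / z) = p / z := by ring
  have a2 : p * (x ^ 2 / z) = p / (z / x ^ 2) := by field_simp
  have a3 : p * (z / x ^ 2) = p * z / x ^ 2 := by ring
  rw [a1] at e1
  rw [a2] at e3
  rw [a3] at e4
  have h5 := qPoch_self_ne_zero hp
  rw [bigTheta, bigTheta, e4, e2, e1, e3]
  rw [e1] at h1
  rw [e3] at h3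
  obtain ⟨h11, h12⟩ := mul_ne_zero_iff.mp h1
  obtain ⟨h31, h32⟩ := mul_ne_zero_iff.mp h3
  have c1 : 1 - z = -z * (1 - 1 / z) := by field_simp; ring
  have c3 : 1 - z / x ^ 2 = -(z / x ^ 2) * (1 - x ^ 2 / z) := by field_simp; ring
  have c4 : -(z / x ^ 2) * (1 - x ^ 2 / z) ≠ 0 :=
    mul_ne_zero (neg_ne_zero.mpr (div_ne_zero hz (pow_ne_zero 2 hx))) h31
  rw [c1, c3]
  refine ⟨mul_ne_zero (mul_ne_zero (mul_ne_zero c4 h4) h32) h5, ?_⟩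
  generalize qPoch (p / (z / x ^ 2)) p = w1 at *
  generalize qPoch (p / z) p = w2 at *
  generalize qPoch (p * z / x ^ 2) p = w3 at *
  generalize qPoch (p / (x ^ 2 * z)) p = w4 at *
  generalize qPoch (p * z) p = w7 at *
  generalize qPoch (x ^ 2 * z) p = w8 at *
  generalize 1 - 1 / z = w5 at *
  generalize 1 - x ^ 2 / z = w6 at *
  field_simp

theorem fusedR22Pref_eq {τ r u : ℂ} (hτ : 0 < τ.im) (hr : 0 < (τ * r).im)
    (hm : baxterR0Den τ r (u - 1) ≠ 0) (h0 : baxterR0Den τ r u ≠ 0)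
    (hp : baxterR0Den τ r (u + 1) ≠ 0) :
    bracket τ r (u - 1) ≠ 0 ∧
      fusedR22Pref τ r u = bracket τ r (u + 1) / bracket τ r (u - 1) := by
  have hr0 : r ≠ 0 := by
    rintro rfl
    simp at hr
  have hx4 : xPow τ r 4 = xPow τ r 1 ^ 4 := by
    rw [show xPow τ r 1 ^ 4 = (xPow τ r 1 * xPow τ r 1) * (xPow τ r 1 * xPow τ r 1) by ring]
    simp only [← xPow_add]
    norm_num
  have hx2 : xPow τ r 2 = xPow τ r 1 ^ 2 := by
    rw [pow_two, ← xPow_add]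
    norm_num
  have hq : ‖xPow τ r 1 ^ 4‖ < 1 := hx4 ▸ norm_xPow_four_lt_one hr
  have hP := norm_nomeP_lt_one hτ
  have zp : xPow τ r (2 * (u + 1)) = xPow τ r 1 ^ 2 * xPow τ r (2 * u) := by
    rw [← hx2, ← xPow_add]
    ring_nf
  have hx := xPow_ne_zero τ r 1
  have hz := xPow_ne_zero τ r (2 * u)
  have zm : xPow τ r (2 * (u - 1)) = xPow τ r (2 * u) / xPow τ r 1 ^ 2 := by
    rw [eq_div_iff (pow_ne_zero 2 hx), ← hx2, ← xPow_add]
    ring_nf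
  rw [(baxterR0_eq τ r _).2] at hm h0 hp
  rw [zp] at hp
  rw [zm] at hm
  have zz : xPow τ r 1 ^ 2 * (xPow τ r (2 * u) / xPow τ r 1 ^ 2) = xPow τ r (2 * u) := by
    field_simp
  obtain ⟨n1, n2, f1⟩ := r0_fusion hx hz hP hq h0 hp
  obtain ⟨n3, n4, f2⟩ := r0_fusion hx (div_ne_zero hz (pow_ne_zero 2 hx)) hP hq hm
    (by rwa [zz])
  rw [zz, one_div_div, ← mul_div_assoc (nomeP τ)] at f2
  rw [one_div_div] at n3
  rw [← mul_div_assoc] at n4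
  obtain ⟨t1, t2⟩ := bracket_quotient hx hz hP n1 n2 n3 n4
  rw [fusedR22Pref, fusedR21Pref, fusedR21Pref, sub_add_cancel, bracket, bracket,
    xPow_two_mul_self hr0, (baxterR0_eq τ r u).1, (baxterR0_eq τ r (u - 1)).1,
    (baxterR0_eq τ r (u + 1)).1, zp, zm]
  refine ⟨mul_ne_zero (xPow_ne_zero _ _ _) t1, ?_⟩
  rw [← f1, ← f2] at t2
  -- Both sides are `x^{4u/r - 2}`: the differences of the quadratic exponents in the brackets are
  -- linear in `u`.
  have key : xPow τ r (-(u * (r - 1) / r)) * xPow τ r (-((u - 1) * (r - 1) / r)) *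
      (xPow τ r (-((u + 1) * (r - 1) / r)) * xPow τ r (-(u * (r - 1) / r))) *
      (xPow τ r (2 * u) * xPow τ r (2 * u) / xPow τ r 1 ^ 2) =
      xPow τ r ((u + 1) ^ 2 / r - (u + 1)) / xPow τ r ((u - 1) ^ 2 / r - (u - 1)) := by
    rw [eq_div_iff (xPow_ne_zero _ _ _), ← hx2, ← mul_div_assoc, div_mul_eq_mul_div,
      div_eq_iff (xPow_ne_zero _ _ _)]
    simp only [← xPow_add]
    congr 1
    field_simp
    ring
  rw [mul_div_mul_comm, ← key]
  linear_combination xPow τ r (-(u * (r - 1) / r)) * xPow τ r (-((u - 1) * (r - 1) / r)) *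
      (xPow τ r (-((u + 1) * (r - 1) / r)) * xPow τ r (-(u * (r - 1) / r))) * t2

/-! ## The Jacobi triple product -/

/-- `(q; q)_n`. -/
noncomputable def qFactorial (q : ℂ) (n : ℕ) : ℂ := ∏ k ∈ Finset.range n, (1 - q ^ (k + 1))

theorem qFactorial_succ (q : ℂ) (n : ℕ) :
    qFactorial q (n + 1) = qFactorial q n * (1 - q ^ (n + 1)) :=
  Finset.prod_range_succ _ n

theorem one_sub_pow_succ_ne_zero {q : ℂ} (hq : ‖q‖ < 1) (n : ℕ) : 1 - q ^ (n + 1) ≠ 0 := by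
  intro h
  have h1 : ‖q ^ (n + 1)‖ < 1 := by
    rw [norm_pow]
    exact pow_lt_one₀ (norm_nonneg q) hq n.succ_ne_zero
  rw [← sub_eq_zero.mp h] at h1
  simp at h1

theorem qFactorial_ne_zero {q : ℂ} (hq : ‖q‖ < 1) (n : ℕ) : qFactorial q n ≠ 0 :=
  Finset.prod_ne_zero_iff.mpr fun k _ => one_sub_pow_succ_ne_zero hq k

/-- The coefficient of `wⁱ` in `∏_{k < N} (1 - w q^k)`. -/
noncomputable def qBinomCoeff (q : ℂ) (N i : ℕ) : ℂ :=
  if i ≤ N then (-1) ^ i * q ^ (i.choose 2) *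
    (qFactorial q N / (qFactorial q i * qFactorial q (N - i))) else 0

theorem qBinomCoeff_zero_right {q : ℂ} (hq : ‖q‖ < 1) (N : ℕ) : qBinomCoeff q N 0 = 1 := by
  simp [qBinomCoeff, qFactorial_ne_zero hq, show qFactorial q 0 = 1 from rfl]

/-- This is the `q`-Pascal rule, with the signs and the powers of `q` absorbed into the
coefficients; the boundary case `i = N` uses the convention that coefficients beyond `N` vanish. -/
theorem qBinomCoeff_succ_succ {q : ℂ} (hq : ‖q‖ < 1) (N i : ℕ) :
    qBinomCoeff q (N + 1) (i + 1) = qBinomCoeff q N (i + 1) - q ^ N * qBinomCoeff q N i := by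
  have hc : (i + 1).choose 2 = i + i.choose 2 := by
    rw [Nat.choose_succ_succ' i 1, Nat.choose_one_right]
  rcases lt_trichotomy i N with h | rfl | h
  · obtain ⟨d, rfl⟩ := Nat.exists_eq_add_of_lt h
    have e1 : i + d + 1 - i = d + 1 := by omega
    have e2 : i + d + 1 - (i + 1) = d := by omega
    have e3 : i + d + 1 + 1 - (i + 1) = d + 1 := by omega
    simp only [qBinomCoeff, e1, e2, e3, hc, show i + 1 ≤ i + d + 1 + 1 by omega,
      show i + 1 ≤ i + d + 1 by omega, show i ≤ i + d + 1 by omega, if_true,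
      qFactorial_succ q (i + d + 1), qFactorial_succ q d, qFactorial_succ q i]
    have h1 := qFactorial_ne_zero hq i
    have h2 := qFactorial_ne_zero hq d
    have h3 := one_sub_pow_succ_ne_zero hq i
    have h4 := one_sub_pow_succ_ne_zero hq d
    field_simp
    ring
  · have h1 := qFactorial_ne_zero hq i
    have h3 := qFactorial_ne_zero hq (i + 1)
    simp only [qBinomCoeff, le_refl, if_true, hc, Nat.sub_self, show ¬ i + 1 ≤ i by omega,
      if_false, show qFactorial q 0 = 1 from rfl, mul_one, div_self h1, div_self h3]
    ring
  · simp [qBinomCoeff, show ¬ i + 1 ≤ N by omega, show ¬ i ≤ N by omega]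

theorem prod_one_sub_mul_pow {q : ℂ} (hq : ‖q‖ < 1) (w : ℂ) (N : ℕ) :
    ∏ k ∈ Finset.range N, (1 - w * q ^ k) =
      ∑ i ∈ Finset.range (N + 1), qBinomCoeff q N i * w ^ i := by
  induction N with
  | zero => simp [qBinomCoeff_zero_right hq]
  | succ N ih =>
    have h0 : qBinomCoeff q N (N + 1) = 0 := by simp [qBinomCoeff]
    -- The sum over `i ≤ N + 1` is split at both ends: its top term vanishes by `h0`, and detaching
    -- `i = 0` shifts the index as the `q`-Pascal rule requires.
    have h1 := Finset.sum_range_succ (fun i => qBinomCoeff q N i * w ^ i) (N + 1)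
    rw [Finset.sum_range_succ', h0, zero_mul, add_zero] at h1
    rw [Finset.prod_range_succ, ih, Finset.sum_range_succ' _ (N + 1)]
    simp only [qBinomCoeff_succ_succ hq, qBinomCoeff_zero_right hq, sub_mul,
      Finset.sum_sub_distrib] at h1 ⊢
    rw [mul_sub, ← h1, mul_one, h1, Finset.sum_mul]
    have h2 : ∑ i ∈ Finset.range (N + 1), q ^ N * qBinomCoeff q N i * w ^ (i + 1) =
        ∑ i ∈ Finset.range (N + 1), qBinomCoeff q N i * w ^ i * (w * q ^ N) :=
      Finset.sum_congr rfl fun i _ => by ring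
    rw [h2]
    linear_combination -h1

theorem jacobiTheta₂_term_add_one (j : ℤ) (v t : ℂ) :
    jacobiTheta₂_term (j + 1) (v + 1 / 2 - t / 2) t =
      jacobiTheta₂_term j (v + 1 / 2 - t / 2) t *
        -(exp (2 * Real.pi * I * v) * exp (2 * Real.pi * I * t) ^ j) := by
  rw [jacobiTheta₂_term, jacobiTheta₂_term, ← exp_int_mul, ← exp_add, ← neg_one_mul,
    ← exp_pi_mul_I, ← exp_add, ← exp_add]
  congr 1
  push_cast
  ring

/-- Inverting the `n` factors of the finite product that carry negative powers of `q` produces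
exactly this monomial; it cancels the lowest theta term, from which `jacobiTheta₂_term_sub` builds
up the others. -/
theorem prod_neg_mul_jacobiTheta₂_term (n : ℕ) (v t : ℂ) :
    (∏ k ∈ Finset.range n, -(exp (2 * Real.pi * I * v) *
      exp (2 * Real.pi * I * t) ^ (-(k + 1 : ℕ) : ℤ))) *
      jacobiTheta₂_term (-n) (v + 1 / 2 - t / 2) t = 1 := by
  induction n with
  | zero => simp [jacobiTheta₂_term]
  | succ n ih =>
    have h := jacobiTheta₂_term_add_one (-(n + 1 : ℕ) : ℤ) v t
    rw [show (-(n + 1 : ℕ) : ℤ) + 1 = -n by push_cast; ring] at h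
    rw [h] at ih
    rw [Finset.prod_range_succ]
    linear_combination ih

theorem jacobiTheta₂_term_sub (n i : ℕ) (v t : ℂ) :
    jacobiTheta₂_term (i - n) (v + 1 / 2 - t / 2) t =
      jacobiTheta₂_term (-n) (v + 1 / 2 - t / 2) t * ((-1) ^ i *
        exp (2 * Real.pi * I * t) ^ (i.choose 2) *
        (exp (2 * Real.pi * I * v) * exp (2 * Real.pi * I * t) ^ (-n : ℤ)) ^ i) := by
  induction i with
  | zero => simp
  | succ i ih =>
    have hc : (i + 1).choose 2 = i + i.choose 2 := by
      rw [Nat.choose_succ_succ' i 1, Nat.choose_one_right]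
    have h := jacobiTheta₂_term_add_one ((i : ℤ) - n) v t
    rw [show ((i + 1 : ℕ) : ℤ) - n = (i : ℤ) - n + 1 by push_cast; ring, h, ih, hc,
      sub_eq_add_neg (i : ℤ), zpow_add₀ (exp_ne_zero _), zpow_natCast]
    ring

/-- The terms of the finite form of the triple product. -/
noncomputable def finiteTripleTerm (v t : ℂ) (n : ℕ) (j : ℤ) : ℂ :=
  if -(n : ℤ) ≤ j ∧ j ≤ n then
    jacobiTheta₂_term j (v + 1 / 2 - t / 2) t *
      (qFactorial (exp (2 * Real.pi * I * t)) (2 * n) /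
        (qFactorial (exp (2 * Real.pi * I * t)) (n + j).toNat *
          qFactorial (exp (2 * Real.pi * I * t)) (n - j).toNat)) else 0

/-- This is the `q`-binomial theorem with `N = 2n` and `w = z q^{-n}`, with the summation index
recentred by `n`. Extending the terms by zero to all integers gives every `n` the same index set,
ready for the passage to the limit. -/
theorem finite_triple_product {t : ℂ} (hq : ‖exp (2 * Real.pi * I * t)‖ < 1) (v : ℂ) (n : ℕ) :
    (∏ k ∈ Finset.range n, (1 - exp (2 * Real.pi * I * v) * exp (2 * Real.pi * I * t) ^ k)) *
      (∏ k ∈ Finset.range n, (1 - exp (2 * Real.pi * I * t) / exp (2 * Real.pi * I * v) *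
        exp (2 * Real.pi * I * t) ^ k)) =
      ∑' j : ℤ, finiteTripleTerm v t n j := by
  have hs : ∑' j : ℤ, finiteTripleTerm v t n j =
      ∑ i ∈ Finset.range (2 * n + 1), finiteTripleTerm v t n (i - n) := by
    rw [tsum_eq_sum (s := Finset.Icc (-(n : ℤ)) n)]
    · refine Finset.sum_nbij' (fun j => (j + n).toNat) (fun i => (i : ℤ) - n) ?_ ?_ ?_ ?_ ?_
      · intro j hj
        simp only [Finset.mem_Icc, Finset.mem_range] at hj ⊢
        omega
      · intro i hi
        simp only [Finset.mem_Icc, Finset.mem_range] at hi ⊢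
        omega
      · intro j hj
        simp only [Finset.mem_Icc] at hj
        omega
      · intro i hi
        simp
      · intro j hj
        simp only [Finset.mem_Icc] at hj
        congr 1
        omega
    · intro j hj
      rw [Finset.mem_Icc] at hj
      simp [finiteTripleTerm, hj]
  have ht : ∀ i ∈ Finset.range (2 * n + 1), finiteTripleTerm v t n (i - n) =
      jacobiTheta₂_term (-n) (v + 1 / 2 - t / 2) t *
        (qBinomCoeff (exp (2 * Real.pi * I * t)) (2 * n) i *
          (exp (2 * Real.pi * I * v) * exp (2 * Real.pi * I * t) ^ (-n : ℤ)) ^ i) := by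
    intro i hi
    rw [Finset.mem_range] at hi
    have e1 : ((n : ℤ) + (i - n)).toNat = i := by omega
    have e2 : ((n : ℤ) - (i - n)).toNat = 2 * n - i := by omega
    rw [finiteTripleTerm, if_pos (by omega), e1, e2, qBinomCoeff, if_pos (by omega),
      jacobiTheta₂_term_sub]
    ring
  rw [hs, Finset.sum_congr rfl ht, ← Finset.mul_sum, ← prod_one_sub_mul_pow hq, two_mul n,
    Finset.prod_range_add]
  have hz := exp_ne_zero (2 * Real.pi * I * v)
  have hq0 := exp_ne_zero (2 * Real.pi * I * t)
  -- In reversed order the `k`-th factor is `1 - z q^{-(k+1)} = -z q^{-(k+1)} (1 - q^{k+1}/z)`.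
  have h1 : ∏ k ∈ Finset.range n, (1 - exp (2 * Real.pi * I * v) *
      exp (2 * Real.pi * I * t) ^ (-n : ℤ) * exp (2 * Real.pi * I * t) ^ k) =
      (∏ k ∈ Finset.range n, -(exp (2 * Real.pi * I * v) *
        exp (2 * Real.pi * I * t) ^ (-(k + 1 : ℕ) : ℤ))) *
      ∏ k ∈ Finset.range n, (1 - exp (2 * Real.pi * I * t) / exp (2 * Real.pi * I * v) *
        exp (2 * Real.pi * I * t) ^ k) := by
    rw [← Finset.prod_mul_distrib, ← Finset.prod_range_reflect]
    refine Finset.prod_congr rfl fun k hk => ?_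
    rw [Finset.mem_range] at hk
    obtain ⟨d, rfl⟩ := Nat.exists_eq_add_of_lt hk
    rw [show k + d + 1 - 1 - k = d by omega, zpow_neg, zpow_neg, zpow_natCast, zpow_natCast]
    field_simp
    ring
  have h2 : ∏ k ∈ Finset.range n, (1 - exp (2 * Real.pi * I * v) *
      exp (2 * Real.pi * I * t) ^ (-n : ℤ) * exp (2 * Real.pi * I * t) ^ (n + k)) =
      ∏ k ∈ Finset.range n, (1 - exp (2 * Real.pi * I * v) * exp (2 * Real.pi * I * t) ^ k) := by
    refine Finset.prod_congr rfl fun k _ => ?_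
    rw [zpow_neg, zpow_natCast, pow_add]
    field_simp
  rw [h1, h2]
  have h3 := prod_neg_mul_jacobiTheta₂_term n v t
  linear_combination (-(∏ k ∈ Finset.range n, (1 - exp (2 * Real.pi * I * v) *
    exp (2 * Real.pi * I * t) ^ k)) *
      (∏ k ∈ Finset.range n, (1 - exp (2 * Real.pi * I * t) / exp (2 * Real.pi * I * v) *
        exp (2 * Real.pi * I * t) ^ k))) * h3

theorem tendsto_qFactorial {q : ℂ} (hq : ‖q‖ < 1) :
    Filter.Tendsto (qFactorial q) Filter.atTop (nhds (qPoch q q)) := by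
  have h := (multipliable_qPoch q hq).tendsto_prod_tprod_nat
  refine h.congr fun n => Finset.prod_congr rfl fun k _ => ?_
  rw [pow_succ']

theorem norm_exp_two_pi_I_mul_lt_one {t : ℂ} (ht : 0 < t.im) :
    ‖exp (2 * Real.pi * I * t)‖ < 1 := by
  rw [norm_exp, Real.exp_lt_one_iff]
  simp
  positivity

/-- The finite identity is passed to the limit term by term, by dominated convergence on the
integers. -/
theorem jacobi_triple_product {t : ℂ} (ht : 0 < t.im) (v : ℂ) :
    qPoch (exp (2 * Real.pi * I * t)) (exp (2 * Real.pi * I * t)) *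
      (qPoch (exp (2 * Real.pi * I * v)) (exp (2 * Real.pi * I * t)) *
        qPoch (exp (2 * Real.pi * I * t) / exp (2 * Real.pi * I * v))
          (exp (2 * Real.pi * I * t))) =
      jacobiTheta₂ (v + 1 / 2 - t / 2) t := by
  have hq := norm_exp_two_pi_I_mul_lt_one ht
  have hfin := finite_triple_product hq v
  set q := exp (2 * Real.pi * I * t) with hqdef
  set z := exp (2 * Real.pi * I * v)
  have hQ := qPoch_self_ne_zero hq
  have hF := tendsto_qFactorial hq
  have hlim1 : Filter.Tendsto (fun n => ∑' j : ℤ, finiteTripleTerm v t n j) Filter.atTop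
      (nhds (qPoch z q * qPoch (q / z) q)) := by
    simp only [← hfin]
    exact (multipliable_qPoch z hq).tendsto_prod_tprod_nat.mul
      (multipliable_qPoch (q / z) hq).tendsto_prod_tprod_nat
  -- Because `(q;q)_n` converges to a nonzero limit, it and its inverse are bounded; this makes the
  -- dominating series independent of `n`.
  obtain ⟨B, hB⟩ := hF.norm.bddAbove_range
  obtain ⟨B', hB'⟩ := (hF.inv₀ hQ).norm.bddAbove_range
  have hB (n : ℕ) : ‖qFactorial q n‖ ≤ B := hB ⟨n, rfl⟩
  have hB' (n : ℕ) : ‖(qFactorial q n)⁻¹‖ ≤ B' := hB' ⟨n, rfl⟩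
  have hB0 : 0 ≤ B := (norm_nonneg _).trans (hB 0)
  have hB0' : 0 ≤ B' := (norm_nonneg _).trans (hB' 0)
  have hlim2 : Filter.Tendsto (fun n => ∑' j : ℤ, finiteTripleTerm v t n j) Filter.atTop
      (nhds (∑' j : ℤ, jacobiTheta₂_term j (v + 1 / 2 - t / 2) t *
        (qPoch q q / (qPoch q q * qPoch q q)))) := by
    refine tendsto_tsum_of_dominated_convergence
      (bound := fun j => ‖jacobiTheta₂_term j (v + 1 / 2 - t / 2) t‖ * (B * (B' * B'))) ?_ ?_ ?_
    · exact ((summable_jacobiTheta₂_term_iff _ t).mpr ht).norm.mul_right _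
    · intro j
      have c1 : Filter.Tendsto (fun n : ℕ => 2 * n) Filter.atTop Filter.atTop :=
        Filter.tendsto_atTop_mono (fun n => by dsimp only [id]; omega) Filter.tendsto_id
      have c2 : Filter.Tendsto (fun n : ℕ => ((n : ℤ) + j).toNat) Filter.atTop Filter.atTop :=
        Filter.tendsto_atTop_mono (f := fun n => n - j.natAbs) (fun n => by omega)
          (Filter.tendsto_sub_atTop_nat _)
      have c3 : Filter.Tendsto (fun n : ℕ => ((n : ℤ) - j).toNat) Filter.atTop Filter.atTop :=
        Filter.tendsto_atTop_mono (f := fun n => n - j.natAbs) (fun n => by omega)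
          (Filter.tendsto_sub_atTop_nat _)
      have c4 := ((hF.comp c1).div ((hF.comp c2).mul (hF.comp c3))
        (mul_ne_zero hQ hQ)).const_mul (jacobiTheta₂_term j (v + 1 / 2 - t / 2) t)
      refine c4.congr' ?_
      filter_upwards [Filter.eventually_ge_atTop j.natAbs] with n hn
      rw [finiteTripleTerm, if_pos (by omega)]
      rfl
    · refine Filter.Eventually.of_forall fun n j => ?_
      rw [finiteTripleTerm]
      split_ifs
      · rw [norm_mul, div_eq_mul_inv (qFactorial _ _), mul_inv,
          norm_mul (qFactorial _ _), norm_mul (qFactorial _ _)⁻¹]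
        gcongr
        · exact hB _
        · exact hB' _
        · exact hB' _
      · rw [norm_zero]
        positivity
  have h := tendsto_nhds_unique hlim1 hlim2
  rw [h, tsum_mul_right, ← jacobiTheta₂]
  field_simp

/-! ## Addition formulas for `ϑ₁` and `ϑ₂` -/

/-- Each cosine factor splits as `(1 - qⁿz)(1 - qⁿ/z)`, and the sine supplies the missing factor `1
- z`. -/
theorem theta1_eq_qPoch {t : ℂ} (ht : 0 < t.im) (v : ℂ) :
    theta1 v t = I * exp (2 * Real.pi * I * t / 8) * exp (-(Real.pi * I * v)) *
      (qPoch (exp (2 * Real.pi * I * t)) (exp (2 * Real.pi * I * t)) *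
      (qPoch (exp (2 * Real.pi * I * v)) (exp (2 * Real.pi * I * t)) *
        qPoch (exp (2 * Real.pi * I * t) / exp (2 * Real.pi * I * v))
          (exp (2 * Real.pi * I * t)))) := by
  have hq := norm_exp_two_pi_I_mul_lt_one ht
  have hz := exp_ne_zero (2 * Real.pi * I * v)
  rw [theta1, qPoch_eq_mul (exp (2 * Real.pi * I * v)) hq]
  have hsin : 2 * sin (Real.pi * v) =
      I * exp (-(Real.pi * I * v)) * (1 - exp (2 * Real.pi * I * v)) := by
    rw [mul_sub, mul_one, mul_assoc I, ← exp_add,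
      show -(Real.pi * I * v) + 2 * Real.pi * I * v = Real.pi * v * I by ring, sin,
      show -(Real.pi * I * v) = -(Real.pi * v) * I by ring]
    ring
  have hcos : 2 * cos (2 * Real.pi * v) =
      exp (2 * Real.pi * I * v) + 1 / exp (2 * Real.pi * I * v) := by
    rw [one_div, ← exp_neg, two_cos]
    ring_nf
  set q := exp (2 * Real.pi * I * t)
  set z := exp (2 * Real.pi * I * v)
  have h1 : ∏' n : ℕ, (1 - q ^ (n + 1)) = qPoch q q :=
    tprod_congr fun n => by rw [pow_succ']
  have h2 : ∏' n : ℕ, (1 - 2 * q ^ (n + 1) * cos (2 * Real.pi * v) + q ^ (2 * (n + 1))) =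
      qPoch (q * z) q * qPoch (q / z) q := by
    rw [qPoch, qPoch, ← (multipliable_qPoch (q * z) hq).tprod_mul (multipliable_qPoch (q / z) hq)]
    refine tprod_congr fun n => ?_
    rw [show 2 * q ^ (n + 1) * cos (2 * Real.pi * v) =
      q ^ (n + 1) * (2 * cos (2 * Real.pi * v)) by ring, hcos]
    field_simp
    ring
  rw [h1, h2]
  linear_combination exp (2 * Real.pi * I * t / 8) * qPoch q q *
    (qPoch (q * z) q * qPoch (q / z) q) * hsin

/-- The terms of the series of `-ϑ₁(v|t)`. -/
noncomputable def thetaTerm (v t : ℂ) (m : ℤ) : ℂ :=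
  exp (Real.pi * I * t * (m - 1 / 2) ^ 2 + 2 * Real.pi * I * (m - 1 / 2) * (v + 1 / 2))

theorem thetaTerm_eq (v t : ℂ) (m : ℤ) :
    thetaTerm v t m = -(I * exp (2 * Real.pi * I * t / 8) * exp (-(Real.pi * I * v))) *
      jacobiTheta₂_term m (v + 1 / 2 - t / 2) t := by
  have h : -(I * exp (2 * Real.pi * I * t / 8) * exp (-(Real.pi * I * v))) =
      exp (-(Real.pi / 2 * I) + 2 * Real.pi * I * t / 8 + -(Real.pi * I * v)) := by
    rw [exp_add, exp_add, exp_neg (Real.pi / 2 * I), exp_pi_div_two_mul_I, inv_I]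
    ring
  rw [h, jacobiTheta₂_term, ← exp_add, thetaTerm]
  ring_nf

theorem hasSum_thetaTerm {t : ℂ} (ht : 0 < t.im) (v : ℂ) :
    HasSum (thetaTerm v t) (-theta1 v t) := by
  have h := (hasSum_jacobiTheta₂_term (v + 1 / 2 - t / 2) ht).mul_left
    (-(I * exp (2 * Real.pi * I * t / 8) * exp (-(Real.pi * I * v))))
  rw [theta1_eq_qPoch ht, jacobi_triple_product ht, ← neg_mul]
  exact h.congr_fun fun m => thetaTerm_eq v t m

theorem summable_norm_thetaTerm {t : ℂ} (ht : 0 < t.im) (v : ℂ) :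
    Summable fun m => ‖thetaTerm v t m‖ := by
  simp only [thetaTerm_eq, norm_mul]
  exact ((summable_jacobiTheta₂_term_iff _ t).mpr ht).norm.mul_left _

/-! ### Quadratic relations through theta series of parameter `2t` -/

/-- The theta series `∑ e^{2πi m² t + 4πi m x}` over the integers. -/
noncomputable def thetaEven (t x : ℂ) : ℂ := jacobiTheta₂ (2 * x) (2 * t)

/-- The theta series `∑ e^{πi (2m+1)² t/2 + 2πi (2m+1) x}` over the integers. -/
noncomputable def thetaOdd (t x : ℂ) : ℂ :=
  exp (Real.pi * I * t / 2 + 2 * Real.pi * I * x) * jacobiTheta₂ (2 * x + t) (2 * t)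

theorem two_mul_im_pos {t : ℂ} (ht : 0 < t.im) : 0 < (2 * t).im := by
  simpa using ht

noncomputable def thetaEvenTerm (t x : ℂ) (a : ℤ) : ℂ := jacobiTheta₂_term a (2 * x) (2 * t)

noncomputable def thetaOddTerm (t x : ℂ) (a : ℤ) : ℂ :=
  exp (Real.pi * I * t / 2 + 2 * Real.pi * I * x) * jacobiTheta₂_term a (2 * x + t) (2 * t)

theorem hasSum_thetaEvenTerm {t : ℂ} (ht : 0 < t.im) (x : ℂ) :
    HasSum (thetaEvenTerm t x) (thetaEven t x) :=
  hasSum_jacobiTheta₂_term _ (two_mul_im_pos ht)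

theorem hasSum_thetaOddTerm {t : ℂ} (ht : 0 < t.im) (x : ℂ) :
    HasSum (thetaOddTerm t x) (thetaOdd t x) :=
  (hasSum_jacobiTheta₂_term _ (two_mul_im_pos ht)).mul_left _

/-- The pairs `(m, n)` of integers, split by the parity of `m + n`. -/
noncomputable def intPairParityEquiv : (ℤ × ℤ) ⊕ (ℤ × ℤ) ≃ ℤ × ℤ :=
  Equiv.ofBijective
    (Sum.elim (fun k => (k.1 + k.2 + 1, k.1 - k.2)) fun k => 
      (k.1 + k.2 + 1, k.1 - k.2 + 1)) <| by
  constructor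
  · rintro (⟨a, b⟩ | ⟨a, b⟩) (⟨c, d⟩ | ⟨c, d⟩) h <;>
      simp only [Sum.elim_inl, Sum.elim_inr, Prod.mk.injEq, Sum.inl.injEq, Sum.inr.injEq,
        reduceCtorEq] at h ⊢ <;> omega
  · rintro ⟨m, n⟩
    rcases Int.even_or_odd' (m + n) with ⟨k, hk | hk⟩
    · exact ⟨Sum.inr (k - 1, m - k), by
        simp only [Sum.elim_inr, Prod.mk.injEq]; omega⟩
    · exact ⟨Sum.inl (k, m - k - 1), by
        simp only [Sum.elim_inl, Prod.mk.injEq]; omega⟩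

theorem intPairParityEquiv_inl (k : ℤ × ℤ) :
    intPairParityEquiv (Sum.inl k) = (k.1 + k.2 + 1, k.1 - k.2) := rfl

theorem intPairParityEquiv_inr (k : ℤ × ℤ) :
    intPairParityEquiv (Sum.inr k) = (k.1 + k.2 + 1, k.1 - k.2 + 1) := rfl

/-- In the double series, `x` is multiplied by `m+n-1` and `y` by `m-n`, two integers of opposite
parity. Since the sum of the squares of `m-1/2` and `n-1/2` is `((m+n-1)² + (m-n)²)/2`, each parity
class factors into an even and an odd theta series. -/
theorem theta1_mul_theta1 {t : ℂ} (ht : 0 < t.im) (x y : ℂ) :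
    theta1 (x + y) t * theta1 (x - y) t =
      thetaEven t x * thetaOdd t y - thetaOdd t x * thetaEven t y := by
  have hsum := summable_mul_of_summable_norm (summable_norm_thetaTerm ht (x + y))
    (summable_norm_thetaTerm ht (x - y))
  have h := (hasSum_thetaTerm ht (x + y)).mul (hasSum_thetaTerm ht (x - y)) hsum
  rw [neg_mul_neg, ← intPairParityEquiv.hasSum_iff] at h
  have he := summable_mul_of_summable_norm (hasSum_thetaEvenTerm ht x).summable.norm
    (hasSum_thetaOddTerm ht y).summable.norm
  have ho := summable_mul_of_summable_norm (hasSum_thetaOddTerm ht x).summable.norm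
    (hasSum_thetaEvenTerm ht y).summable.norm
  have h1 := (hasSum_thetaEvenTerm ht x).mul (hasSum_thetaOddTerm ht y) he
  have h2 := ((hasSum_thetaOddTerm ht x).mul (hasSum_thetaEvenTerm ht y) ho).neg
  rw [sub_eq_add_neg (thetaEven t x * thetaOdd t y)]
  refine h.unique (HasSum.sum ?_ ?_)
  · refine h1.congr_fun fun k => ?_
    simp only [Function.comp_apply, intPairParityEquiv_inl,
      thetaTerm, thetaEvenTerm, thetaOddTerm, jacobiTheta₂_term, ← exp_add]
    -- The half in `v + 1/2` contributes `e^{πi(m+n-1)} = e^{2πi k.1} = 1`; in the other class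
    -- `m+n-1 = 2 k.1 + 1`, whence the minus sign.
    refine exp_eq_exp_iff_exists_int.mpr ⟨k.1, ?_⟩
    push_cast
    ring
  · refine h2.congr_fun fun k => ?_
    simp only [Function.comp_apply, intPairParityEquiv_inr,
      thetaTerm, thetaEvenTerm, thetaOddTerm, jacobiTheta₂_term, ← exp_add]
    rw [← neg_one_mul, ← exp_pi_mul_I, ← exp_add]
    refine exp_eq_exp_iff_exists_int.mpr ⟨k.1, ?_⟩
    push_cast
    ring

theorem thetaEven_neg (t x : ℂ) : thetaEven t (-x) = thetaEven t x := by
  rw [thetaEven, mul_neg, jacobiTheta₂_neg_left, thetaEven]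

theorem thetaEven_add_half (t x : ℂ) : thetaEven t (x + 1 / 2) = thetaEven t x := by
  rw [thetaEven, mul_add, mul_one_div_cancel two_ne_zero, jacobiTheta₂_add_left, thetaEven]

theorem thetaOdd_neg (t x : ℂ) : thetaOdd t (-x) = thetaOdd t x := by
  rw [thetaOdd, thetaOdd, show 2 * x + t = (2 * x - t) + 2 * t by ring, jacobiTheta₂_add_left',
    show 2 * -x + t = -(2 * x - t) by ring, jacobiTheta₂_neg_left, ← mul_assoc, ← exp_add]
  ring_nf

theorem thetaOdd_add_half (t x : ℂ) : thetaOdd t (x + 1 / 2) = -thetaOdd t x := by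
  rw [thetaOdd, thetaOdd, show 2 * (x + 1 / 2) + t = 2 * x + t + 1 by ring, jacobiTheta₂_add_left,
    show Real.pi * I * t / 2 + 2 * Real.pi * I * (x + 1 / 2) =
      Real.pi * I * t / 2 + 2 * Real.pi * I * x + Real.pi * I by ring, exp_add, exp_pi_mul_I]
  ring

theorem theta2_mul_theta2 {t : ℂ} (ht : 0 < t.im) (x y : ℂ) :
    theta2 (x + y) t * theta2 (x - y) t =
      thetaEven t x * thetaOdd t y + thetaOdd t x * thetaEven t y := by
  have h := theta1_mul_theta1 ht (x + 1 / 2) y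
  rw [thetaEven_add_half, thetaOdd_add_half, add_right_comm, add_sub_right_comm] at h
  rw [theta2, theta2, h]
  ring

/-- Shifting by a quarter puts the half-period on one factor only. At these points the odd series
becomes an odd function, hence vanishes for argument `0`, which is what makes
`theta1_mul_theta2_add` collapse. -/
theorem theta1_mul_theta2 {t : ℂ} (ht : 0 < t.im) (x y : ℂ) :
    theta1 (x + y) t * theta2 (x - y) t =
      -(thetaEven t (x + 1 / 4) * thetaOdd t (y + 1 / 4) +
        thetaOdd t (x + 1 / 4) * thetaEven t (y + 1 / 4)) := by
  have h := theta1_mul_theta1 ht (x + 1 / 4) (y - 1 / 4)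
  have h1 := thetaEven_add_half t (y - 1 / 4)
  have h2 := thetaOdd_add_half t (y - 1 / 4)
  rw [show y - 1 / 4 + 1 / 2 = y + 1 / 4 by ring] at h1 h2
  rw [show x + 1 / 4 + (y - 1 / 4) = x + y by ring,
    show x + 1 / 4 - (y - 1 / 4) = x - y + 1 / 2 by ring] at h
  rw [theta2, h, h1, h2]
  ring

theorem thetaEven_neg_add_quarter (t x : ℂ) :
    thetaEven t (-x + 1 / 4) = thetaEven t (x + 1 / 4) := by
  rw [← thetaEven_neg t (-x + 1 / 4), ← thetaEven_add_half]
  ring_nf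

theorem thetaOdd_neg_add_quarter (t x : ℂ) :
    thetaOdd t (-x + 1 / 4) = -thetaOdd t (x + 1 / 4) := by
  rw [← thetaOdd_neg t (-x + 1 / 4), ← neg_neg (thetaOdd t (-(-x + 1 / 4))),
    ← thetaOdd_add_half]
  ring_nf

/-- `ϑ₁(x+y) ϑ₁(x-y) ϑ₂(0)² = ϑ₁(x)² ϑ₂(y)² - ϑ₂(x)² ϑ₁(y)²`. -/
theorem theta1_add_mul_theta1_sub {t : ℂ} (ht : 0 < t.im) (x y : ℂ) :
    theta1 (x + y) t * theta1 (x - y) t * theta2 0 t ^ 2 =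
      theta1 x t ^ 2 * theta2 y t ^ 2 - theta2 x t ^ 2 * theta1 y t ^ 2 := by
  have sq1 (v : ℂ) := theta1_mul_theta1 ht v 0
  have sq2 (v : ℂ) := theta2_mul_theta2 ht v 0
  simp only [add_zero, sub_zero, ← pow_two] at sq1 sq2
  rw [theta1_mul_theta1 ht, sq1, sq1, sq2, sq2, sq2]
  ring

/-- `ϑ₂(x+y) ϑ₂(x-y) ϑ₂(0)² = ϑ₂(x)² ϑ₂(y)² - ϑ₁(x)² ϑ₁(y)²`. -/
theorem theta2_add_mul_theta2_sub {t : ℂ} (ht : 0 < t.im) (x y : ℂ) :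
    theta2 (x + y) t * theta2 (x - y) t * theta2 0 t ^ 2 =
      theta2 x t ^ 2 * theta2 y t ^ 2 - theta1 x t ^ 2 * theta1 y t ^ 2 := by
  have sq1 (v : ℂ) := theta1_mul_theta1 ht v 0
  have sq2 (v : ℂ) := theta2_mul_theta2 ht v 0
  simp only [add_zero, sub_zero, ← pow_two] at sq1 sq2
  rw [theta2_mul_theta2 ht, sq1, sq1, sq2, sq2, sq2]
  ring

/-- `(ϑ₁(x+y) ϑ₂(x-y) + ϑ₁(x-y) ϑ₂(x+y)) ϑ₁(y) ϑ₂(y) = ϑ₁(x) ϑ₂(x) ϑ₁(2y) ϑ₂(0)`. -/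
theorem theta1_mul_theta2_add {t : ℂ} (ht : 0 < t.im) (x y : ℂ) :
    (theta1 (x + y) t * theta2 (x - y) t + theta1 (x - y) t * theta2 (x + y) t) *
      (theta1 y t * theta2 y t) = theta1 x t * theta2 x t * (theta1 (2 * y) t * theta2 0 t) := by
  have h1 := theta1_mul_theta2 ht x y
  have h2 := theta1_mul_theta2 ht x (-y)
  have h3 := theta1_mul_theta2 ht y y
  have h4 := theta1_mul_theta2 ht y 0
  have h5 := theta1_mul_theta2 ht x 0
  have h6 := thetaOdd_neg_add_quarter t 0
  rw [thetaEven_neg_add_quarter, thetaOdd_neg_add_quarter, sub_neg_eq_add,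
    ← sub_eq_add_neg] at h2
  rw [← two_mul, sub_self] at h3
  rw [add_zero, sub_zero] at h4 h5
  rw [neg_zero, self_eq_neg] at h6
  rw [h1, h2, h3, h4, h5, h6]
  ring

theorem theta2_zero_ne_zero {t : ℂ} (ht : 0 < t.im) : theta2 0 t ≠ 0 := by
  have hq := norm_exp_two_pi_I_mul_lt_one ht
  have hz : exp (2 * Real.pi * I * (0 + 1 / 2)) = -1 := by
    rw [← exp_pi_mul_I]
    ring_nf
  rw [theta2, theta1_eq_qPoch ht, hz]
  have h1 (n : ℕ) : exp (2 * Real.pi * I * t) ^ (n + 1) ≠ -1 := fun h => by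
    have h2 : ‖exp (2 * Real.pi * I * t) ^ (n + 1)‖ < 1 := by
      rw [norm_pow]
      exact pow_lt_one₀ (norm_nonneg _) hq n.succ_ne_zero
    rw [h] at h2
    simp at h2
  refine mul_ne_zero (mul_ne_zero (mul_ne_zero I_ne_zero (exp_ne_zero _)) (exp_ne_zero _))
    (mul_ne_zero (qPoch_self_ne_zero hq) (mul_ne_zero ?_ ?_))
  · refine qPoch_ne_zero hq fun n h => ?_
    rw [neg_one_mul, neg_eq_iff_eq_neg] at h
    cases n with
    | zero => norm_num at h
    | succ n => exact h1 n h
  · refine qPoch_ne_zero hq fun n h => h1 n ?_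
    rw [div_neg, div_one, neg_mul, neg_eq_iff_eq_neg, ← pow_succ'] at h
    exact h

/-! ## Operators on tensor legs -/

/-- Only the states that agree with `s` off the legs `i` and `j` contribute, and these are
parametrised by their two values there. -/
theorem onLegs_mulVec (A : Matrix (Fin 2 × Fin 2) (Fin 2 × Fin 2) ℂ) {i j : Fin 4} (hij : i ≠ j)
    (f : (Fin 4 → Fin 2) → ℂ) (s : Fin 4 → Fin 2) :
    (onLegs A i j).mulVec f s =
      ∑ c : Fin 2 × Fin 2, A (s i, s j) c *
        f (Function.update (Function.update s i c.1) j c.2) := by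
  change ∑ t, onLegs A i j s t * f t = _
  symm
  refine Finset.sum_of_injOn (ι := Fin 2 × Fin 2) (κ := Fin 4 → Fin 2) (M := ℂ)
    (fun c : Fin 2 × Fin 2 => Function.update (Function.update s i c.1) j c.2) ?_ ?_ ?_ ?_
  · rintro ⟨a, b⟩ - ⟨c, d⟩ - h
    have h1 := congrFun h i
    have h2 := congrFun h j
    simp_all
  · intro c _
    simp
  · intro t _ ht
    have : ¬ ∀ k, k ≠ i → k ≠ j → s k = t k := by
      intro h
      refine ht ⟨(t i, t j), by simp, ?_⟩
      funext k
      by_cases hj : k = j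
      · subst hj
        simp
      · by_cases hi : k = i
        · subst hi
          simp [hj]
        · simp [hi, hj, h k hi hj]
    simp [onLegs, this]
  · rintro ⟨a, b⟩ _
    have : ∀ k, k ≠ i → k ≠ j → s k = Function.update (Function.update s i a) j b k := by
      intro k hi hj
      simp [hi, hj]
    simp only [onLegs, Matrix.of_apply, if_pos this, Function.update_self,
      Function.update_of_ne hij]

theorem onLegs_smul (c : ℂ) (A : Matrix (Fin 2 × Fin 2) (Fin 2 × Fin 2) ℂ) (i j : Fin 4) :
    onLegs (c • A) i j = c • onLegs A i j := by
  ext s t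
  simp [onLegs]

theorem update_zero_one (a b c d x y : Fin 2) :
    Function.update (Function.update ![a, b, c, d] 0 x) 1 y = ![x, y, c, d] := by
  ext k; fin_cases k <;> rfl

theorem update_two_three (a b c d x y : Fin 2) :
    Function.update (Function.update ![a, b, c, d] 2 x) 3 y = ![a, b, x, y] := by
  ext k; fin_cases k <;> rfl

theorem update_zero_two (a b c d x y : Fin 2) :
    Function.update (Function.update ![a, b, c, d] 0 x) 2 y = ![x, b, y, d] := by
  ext k; fin_cases k <;> rfl

theorem update_one_two (a b c d x y : Fin 2) :
    Function.update (Function.update ![a, b, c, d] 1 x) 2 y = ![a, x, y, d] := by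
  ext k; fin_cases k <;> rfl

theorem update_zero_three (a b c d x y : Fin 2) :
    Function.update (Function.update ![a, b, c, d] 0 x) 3 y = ![x, b, c, y] := by
  ext k; fin_cases k <;> rfl

theorem update_one_three (a b c d x y : Fin 2) :
    Function.update (Function.update ![a, b, c, d] 1 x) 3 y = ![a, x, c, y] := by
  ext k; fin_cases k <;> rfl

theorem sum_symProj_mul (g : Fin 2 × Fin 2 → ℂ) (a b : Fin 2) :
    ∑ c : Fin 2 × Fin 2, symProj (a, b) c * g c = (g (a, b) + g (b, a)) / 2 := by
  have h (c : Fin 2 × Fin 2) : symProj (a, b) c * g c =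
      (if c = (b, a) then g c / 2 else 0) + (if c = (a, b) then g c / 2 else 0) := by
    have e : ((a, b) = c.swap) ↔ c = (b, a) := by
      rw [eq_comm, Prod.swap_eq_iff_eq_swap, Prod.swap_prod_mk]
    have e' : ((a, b) = c) ↔ c = (a, b) := eq_comm
    simp only [symProj, permP, Matrix.smul_apply, Matrix.add_apply, Matrix.of_apply,
      Matrix.one_apply, smul_eq_mul, e, e']
    split_ifs <;> ring
  simp only [h, Finset.sum_add_distrib, Finset.sum_ite_eq', Finset.mem_univ, if_true]
  ring

/-! ### First fusion of eight-vertex weights -/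

/-- The matrix of eight-vertex weights `a, b, c, d`. -/
noncomputable def eightVertex (a b c d : ℂ) : Matrix (Fin 2 × Fin 2) (Fin 2 × Fin 2) ℂ :=
  (!![a, 0, 0, d; 0, b, c, 0; 0, c, b, 0; d, 0, 0, a] :
    Matrix (Fin (2 * 2)) (Fin (2 * 2)) ℂ).submatrix finProdFinEquiv finProdFinEquiv

theorem sum_eightVertex_mul (a b c d : ℂ) (g : Fin 2 × Fin 2 → ℂ) (i j : Fin 2) :
    ∑ x : Fin 2 × Fin 2, eightVertex a b c d (i, j) x * g x =
      if i = j then a * g (i, j) + d * g (i.rev, j.rev)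
      else b * g (i, j) + c * g (i.rev, j.rev) := by
  rw [Fintype.sum_prod_type]
  simp only [Fin.sum_univ_two]
  fin_cases i <;> fin_cases j <;>
    simp [eightVertex, finProdFinEquiv, Matrix.of_apply] <;> try ring

/-- `Π₁₂ W'_{1j} W_{2j}`. -/
noncomputable def fuseLegs (W' W : Matrix (Fin 2 × Fin 2) (Fin 2 × Fin 2) ℂ) (j : Fin 4) :
    Matrix (Fin 4 → Fin 2) (Fin 4 → Fin 2) ℂ :=
  onLegs symProj 0 1 * onLegs W' 0 j * onLegs W 1 j

/-- The matrix on `V⁽²⁾ ⊗ V` obtained by fusion from eight-vertex weights; the unstarred entries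
are those on `v₊⊗v₊⊗v₊`, the starred ones those on `v₊⊗v₊⊗v₋`. -/
structure FusedWeights where
  (α β γ αs βs γs ε φ ψ : ℂ)

/-- The weights `Π₁₂ W'_{1j} W_{2j}` obtained from the weights of `W` (unprimed) and of `W'`. -/
noncomputable def fuseWeights (a b c d a' b' c' d' : ℂ) : FusedWeights where
  α := a * a'
  β := a * d' + d * b'
  γ := d * c'
  αs := b * b'
  βs := b * c' + c * a'
  γs := c * d'
  ε := b * a' + c * c'
  φ := c * b'
  ψ := b * d'

/-- The matrix of `FusedWeights` on `V⁽²⁾ ⊗ V`, rows being outputs. -/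
noncomputable def FusedWeights.matrix (w : FusedWeights) : Matrix (Fin 3 × Fin 2) (Fin 3 × Fin 2) ℂ :=
  Matrix.of fun i j =>
    !![!![w.α, 0; 0, w.αs] i.2 j.2, !![0, w.ψ; w.φ, 0] i.2 j.2, !![w.γs, 0; 0, w.γ] i.2 j.2;
      !![0, w.βs; w.β, 0] i.2 j.2, !![w.ε, 0; 0, w.ε] i.2 j.2, !![0, w.β; w.βs, 0] i.2 j.2;
      !![w.γ, 0; 0, w.γs] i.2 j.2, !![0, w.φ; w.ψ, 0] i.2 j.2, !![w.αs, 0; 0, w.α] i.2 j.2]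
      i.1 j.1

/-- The relations by which `Π₁₂ W'_{1j} W_{2j}` vanishes on antisymmetric tensors. -/
structure FusionRelations (a b c d a' b' c' d' : ℂ) : Prop where
  bd : b * d' = d * a'
  cb : c * b' = a * c'
  ba : b * a' + c * c' = a * b' + d * d'

/-- Symmetrisation puts the output in `V⁽²⁾` automatically. The relations enter only for the middle
basis vector, where they replace the average over `v₊⊗v₋` and `v₋⊗v₊` by one of the two. -/
theorem fuse_eightVertex {a b c d a' b' c' d' : ℂ} (h : FusionRelations a b c d a' b' c' d')
    (μ : Fin 3) (y : Fin 2 → ℂ) (A : Fin 2 → Fin 2 → Fin 2 → ℂ)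
    (hA : ∀ p q r, A p q r = ∑ v : Fin 2 × Fin 2, eightVertex a' b' c' d' (p, r) v *
      ∑ v' : Fin 2 × Fin 2, eightVertex a b c d (q, v.2) v' * (symVec μ v.1 v'.1 * y v'.2))
    (i j k : Fin 2) :
    (A i j k + A j i k) / 2 = ∑ ν : Fin 3, (∑ l : Fin 2,
      (fuseWeights a b c d a' b' c' d').matrix (ν, k) (μ, l) * y l) * symVec ν i j := by
  simp only [hA, sum_eightVertex_mul]
  simp only [Fin.sum_univ_succ, Fin.sum_univ_zero]
  fin_cases μ <;> fin_cases i <;> fin_cases j <;> fin_cases k <;>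
    simp [symVec, FusedWeights.matrix, fuseWeights, Fin.rev] <;>
    first
    | ring1
    | linear_combination -(y 0 / 2) * h.bd
    | linear_combination -(y 1 / 2) * h.bd
    | linear_combination -(y 0 / 2) * h.cb
    | linear_combination -(y 1 / 2) * h.cb
    | linear_combination -(y 0 / 4) * h.ba
    | linear_combination -(y 1 / 4) * h.ba

/-- The extension by linearity to sums over `κ`, needed because the first fused operator turns a
basis vector into such a sum before the second one acts. -/
theorem fuse_eightVertex_sum {a b c d a' b' c' d' : ℂ}
    (h : FusionRelations a b c d a' b' c' d')
    (y : Fin 3 → Fin 2 → ℂ) (A : Fin 2 → Fin 2 → Fin 2 → ℂ)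
    (hA : ∀ p q r, A p q r = ∑ v : Fin 2 × Fin 2, eightVertex a' b' c' d' (p, r) v *
      ∑ v' : Fin 2 × Fin 2, eightVertex a b c d (q, v.2) v' *
        ∑ κ : Fin 3, y κ v'.2 * symVec κ v.1 v'.1)
    (i j k : Fin 2) :
    (A i j k + A j i k) / 2 = ∑ ν : Fin 3, (∑ κ : Fin 3, ∑ l : Fin 2,
      (fuseWeights a b c d a' b' c' d').matrix (ν, k) (κ, l) * y κ l) * symVec ν i j := by
  let B (κ : Fin 3) (p q r : Fin 2) : ℂ :=
    ∑ v : Fin 2 × Fin 2, eightVertex a' b' c' d' (p, r) v *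
      ∑ v' : Fin 2 × Fin 2, eightVertex a b c d (q, v.2) v' * (symVec κ v.1 v'.1 * y κ v'.2)
  have hB (κ : Fin 3) := fuse_eightVertex h κ (y κ) (B κ) (fun _ _ _ => rfl) i j k
  have e (p q r) : A p q r = ∑ κ, B κ p q r := by
    rw [hA, Finset.sum_comm]
    refine Finset.sum_congr rfl fun v _ => ?_
    simp only [Finset.mul_sum]
    rw [Finset.sum_comm]
    exact Finset.sum_congr rfl fun _ _ => Finset.sum_congr rfl fun _ _ => by ring
  rw [e, e, ← Finset.sum_add_distrib, Finset.sum_div, Finset.sum_congr rfl fun κ _ => hB κ,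
    Finset.sum_comm]
  exact Finset.sum_congr rfl fun ν _ => (Finset.sum_mul _ _ _).symm

theorem fuseLegs_two_mulVec (W' W : Matrix (Fin 2 × Fin 2) (Fin 2 × Fin 2) ℂ)
    (f : (Fin 4 → Fin 2) → ℂ) (i j k l : Fin 2) :
    (fuseLegs W' W 2).mulVec f ![i, j, k, l] =
      ((∑ v : Fin 2 × Fin 2, W' (i, k) v * ∑ v' : Fin 2 × Fin 2, W (j, v.2) v' *
          f ![v.1, v'.1, v'.2, l]) +
        ∑ v : Fin 2 × Fin 2, W' (j, k) v * ∑ v' : Fin 2 × Fin 2, W (i, v.2) v' *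
          f ![v.1, v'.1, v'.2, l]) / 2 := by
  rw [fuseLegs, ← Matrix.mulVec_mulVec, ← Matrix.mulVec_mulVec, onLegs_mulVec _ (by decide)]
  refine (sum_symProj_mul (fun c => _) i j).trans ?_
  simp only [update_zero_one, onLegs_mulVec _ (show (0 : Fin 4) ≠ 2 by decide), update_zero_two,
    onLegs_mulVec _ (show (1 : Fin 4) ≠ 2 by decide), update_one_two]
  rfl

theorem fuseLegs_three_mulVec (W' W : Matrix (Fin 2 × Fin 2) (Fin 2 × Fin 2) ℂ)
    (f : (Fin 4 → Fin 2) → ℂ) (i j k l : Fin 2) :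
    (fuseLegs W' W 3).mulVec f ![i, j, k, l] =
      ((∑ v : Fin 2 × Fin 2, W' (i, l) v * ∑ v' : Fin 2 × Fin 2, W (j, v.2) v' *
          f ![v.1, v'.1, k, v'.2]) +
        ∑ v : Fin 2 × Fin 2, W' (j, l) v * ∑ v' : Fin 2 × Fin 2, W (i, v.2) v' *
          f ![v.1, v'.1, k, v'.2]) / 2 := by
  rw [fuseLegs, ← Matrix.mulVec_mulVec, ← Matrix.mulVec_mulVec, onLegs_mulVec _ (by decide)]
  refine (sum_symProj_mul (fun c => _) i j).trans ?_
  simp only [update_zero_one, onLegs_mulVec _ (show (0 : Fin 4) ≠ 3 by decide), update_zero_three,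
    onLegs_mulVec _ (show (1 : Fin 4) ≠ 3 by decide), update_one_three]
  rfl

/-- The coefficient of `v⁽²⁾_ν` in the action of the two successive fused operators on
`v⁽²⁾_{μ₁} ⊗ v⁽²⁾_{μ₂}`. -/
noncomputable def fusedCoeff (w w' : FusedWeights) (μ : Fin 3 × Fin 3) (ν : Fin 3) (k l : Fin 2) : ℂ :=
  ∑ κ : Fin 3, ∑ m : Fin 2, w'.matrix (ν, l) (κ, m) *
    ∑ n : Fin 2, w.matrix (κ, k) (μ.1, n) * symVec μ.2 n m

theorem fused_mulVec_symVec₂ {a b c d a' b' c' d' e₁ e₂ e₃ e₄ e₁' e₂' e₃' e₄' : ℂ}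
    (h : FusionRelations a b c d a' b' c' d')
    (h' : FusionRelations e₁ e₂ e₃ e₄ e₁' e₂' e₃' e₄') (μ : Fin 3 × Fin 3) (i j k l : Fin 2) :
    (onLegs symProj 2 3 * fuseLegs (eightVertex e₁' e₂' e₃' e₄') (eightVertex e₁ e₂ e₃ e₄) 3 *
      fuseLegs (eightVertex a' b' c' d') (eightVertex a b c d) 2).mulVec (symVec₂ μ)
        ![i, j, k, l] =
      ∑ ν : Fin 3, symVec ν i j *
        ((fusedCoeff (fuseWeights a b c d a' b' c' d')
            (fuseWeights e₁ e₂ e₃ e₄ e₁' e₂' e₃' e₄') μ ν k l +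
          fusedCoeff (fuseWeights a b c d a' b' c' d')
            (fuseWeights e₁ e₂ e₃ e₄ e₁' e₂' e₃' e₄') μ ν l k) / 2) := by
  have step1 (i j k l : Fin 2) :
      (fuseLegs (eightVertex a' b' c' d') (eightVertex a b c d) 2).mulVec (symVec₂ μ)
        ![i, j, k, l] = ∑ κ : Fin 3, (∑ n : Fin 2,
          (fuseWeights a b c d a' b' c' d').matrix (κ, k) (μ.1, n) * symVec μ.2 n l) *
            symVec κ i j := by
    rw [fuseLegs_two_mulVec]
    exact fuse_eightVertex h μ.1 (fun n => symVec μ.2 n l) _ (fun p q r => rfl) i j k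
  have step2 (i j k l : Fin 2) :
      (fuseLegs (eightVertex e₁' e₂' e₃' e₄') (eightVertex e₁ e₂ e₃ e₄) 3).mulVec
        ((fuseLegs (eightVertex a' b' c' d') (eightVertex a b c d) 2).mulVec (symVec₂ μ))
        ![i, j, k, l] = ∑ ν : Fin 3, fusedCoeff (fuseWeights a b c d a' b' c' d')
            (fuseWeights e₁ e₂ e₃ e₄ e₁' e₂' e₃' e₄') μ ν k l * symVec ν i j := by
    rw [fuseLegs_three_mulVec]
    simp only [step1]
    exact fuse_eightVertex_sum h' (fun κ m => ∑ n : Fin 2,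
      (fuseWeights a b c d a' b' c' d').matrix (κ, k) (μ.1, n) * symVec μ.2 n m) _
      (fun p q r => rfl) i j l
  rw [← Matrix.mulVec_mulVec, ← Matrix.mulVec_mulVec, onLegs_mulVec _ (by decide)]
  refine (sum_symProj_mul (fun c => _) k l).trans ?_
  simp only [update_two_three, step2]
  rw [← Finset.sum_add_distrib, Finset.sum_div]
  exact Finset.sum_congr rfl fun ν _ => by ring

/-! ### Second fusion and the pattern of the 81 entries -/

/-- The relations by which the product of two fused operators vanishes on tensors that are
antisymmetric in the last two factors; the weights `w'` act after the weights `w`. -/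
structure DoubleFusionRelations (w w' : FusedWeights) : Prop where
  plus_As : w.α * w'.γ + w.γ * w'.αs = w.β * w'.φ
  minus_A : w.αs * w'.γs + w.γs * w'.α = w.βs * w'.ψ
  zero_C : w.ε * w'.φ + w.φ * w'.α + w.ψ * w'.γs = w.βs * w'.ε
  zero_Cs : w.ε * w'.ψ + w.φ * w'.γ + w.ψ * w'.αs = w.β * w'.ε
  plus_F : w.α * w'.αs + w.β * w'.ψ + w.γ * w'.γ = w.ε * w'.ε
  minus_F : w.αs * w'.α + w.βs * w'.φ + w.γs * w'.γs = w.ε * w'.ε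
  plus_C : w.α * w'.βs + w.γ * w'.β = w.βs * w'.ε
  minus_Cs : w.αs * w'.β + w.γs * w'.βs = w.β * w'.ε
  plus_D : w.α * w'.γs + w.β * w'.φ + w.γ * w'.α = w.φ * w'.β + w.ψ * w'.βs
  minus_D : w.αs * w'.γ + w.βs * w'.ψ + w.γs * w'.αs = w.φ * w'.β + w.ψ * w'.βs
  zero_B : w.φ * w'.γs + w.ψ * w'.α = w.ε * w'.ψ
  zero_Bs : w.φ * w'.αs + w.ψ * w'.γ = w.ε * w'.φ

/-- The `9 × 9` matrix with the sparsity pattern and the symmetries of `R^{(2,2)}`. -/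
noncomputable def nineMatrix (A B C D E F G H J As Bs Cs Gs Hs Js : ℂ) :
    Matrix (Fin 3 × Fin 3) (Fin 3 × Fin 3) ℂ :=
  (!![G,  0,  A,  0,  B,  0,  A,  0,  H;
      0,  F,  0,  C,  0,  Cs, 0,  D,  0;
      As, 0,  Gs, 0,  Bs, 0,  Hs, 0,  As;
      0,  C,  0,  F,  0,  D,  0,  Cs, 0;
      J,  0,  Js, 0,  E,  0,  Js, 0,  J;
      0,  Cs, 0,  D,  0,  F,  0,  C,  0;
      As, 0,  Hs, 0,  Bs, 0,  Gs, 0,  As;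
      0,  D,  0,  Cs, 0,  C,  0,  F,  0;
      H,  0,  A,  0,  B,  0,  A,  0,  G] : Matrix (Fin (3 * 3)) (Fin (3 * 3)) ℂ).submatrix
    finProdFinEquiv finProdFinEquiv

/-- The matrix elements of the product of two fused operators. -/
noncomputable def doubleFusion (w w' : FusedWeights) : Matrix (Fin 3 × Fin 3) (Fin 3 × Fin 3) ℂ :=
  nineMatrix (w.βs * w'.ψ) (w.ε * w'.ψ) (w.βs * w'.ε) (w.φ * w'.β + w.ψ * w'.βs)
    (w.ε * w'.ε + w.φ * w'.βs + w.ψ * w'.β) (w.ε * w'.ε) (w.α * w'.α + w.γ * w'.γs)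
    (w.β * w'.ψ) (w.α * w'.β + w.β * w'.ε + w.γ * w'.βs)
    (w.β * w'.φ) (w.ε * w'.φ) (w.β * w'.ε) (w.αs * w'.αs + w.γs * w'.γ)
    (w.βs * w'.φ) (w.αs * w'.βs + w.βs * w'.ε + w.γs * w'.β)

set_option maxHeartbeats 4000000 in
-- The hypotheses serve two purposes: for `μ₂ = 1` they make the orders `v₊⊗v₋` and `v₋⊗v₊` of the
-- last two factors agree, and they identify the different expressions arising at positions
-- exchanged by `P`. The spin-flip symmetry costs nothing, being built into `FusedWeights.matrix`.
theorem fusedCoeff_symm {w w' : FusedWeights} (h : DoubleFusionRelations w w')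
    (μ₁ μ₂ ν : Fin 3) (k l : Fin 2) :
    (fusedCoeff w w' (μ₁, μ₂) ν k l + fusedCoeff w w' (μ₁, μ₂) ν l k) / 2 =
      ∑ ν' : Fin 3, doubleFusion w w' (ν, ν') (μ₁, μ₂) * symVec ν' k l := by
  simp only [fusedCoeff, Fin.sum_univ_succ, Fin.sum_univ_zero]
  fin_cases μ₁ <;> fin_cases ν <;> fin_cases μ₂ <;> fin_cases k <;> fin_cases l <;>
    simp [symVec, FusedWeights.matrix, doubleFusion, nineMatrix, finProdFinEquiv] <;>
    first
    | ring1
    | linear_combination h.plus_As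
    | linear_combination h.minus_A
    | linear_combination (1 / 2) * h.zero_C
    | linear_combination (1 / 2) * h.zero_Cs
    | linear_combination (1 / 4) * h.plus_F + (1 / 4) * h.minus_F
    | linear_combination (1 / 2) * h.plus_C
    | linear_combination (1 / 2) * h.minus_Cs
    | linear_combination (1 / 4) * h.plus_D + (1 / 4) * h.minus_D
    | linear_combination (1 / 2) * h.zero_B
    | linear_combination (1 / 2) * h.zero_Bs

/-! ### Uniqueness of the matrix elements -/

theorem sum_symVec_mul_injective {g : Fin 3 → ℂ} (h : ∀ k l, ∑ ν, g ν * symVec ν k l = 0) :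
    g = 0 := by
  funext ν
  fin_cases ν
  · simpa [Fin.sum_univ_succ, symVec] using h 0 0
  · simpa [Fin.sum_univ_succ, symVec] using h 0 1
  · simpa [Fin.sum_univ_succ, symVec] using h 1 1

theorem sum_symVec₂_injective {M N : Fin 3 × Fin 3 → ℂ}
    (h : ∑ ν, M ν • symVec₂ ν = ∑ ν, N ν • symVec₂ ν) : M = N := by
  have h1 (k l) : (fun ν₁ => ∑ ν₂, (M (ν₁, ν₂) - N (ν₁, ν₂)) * symVec ν₂ k l) = 0 := by
    refine sum_symVec_mul_injective fun i j => ?_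
    have := congrFun h ![i, j, k, l]
    simp only [Finset.sum_apply, Pi.smul_apply, smul_eq_mul, symVec₂, Fintype.sum_prod_type] at this
    rw [← sub_eq_zero, ← Finset.sum_sub_distrib] at this
    rw [← this]
    refine Finset.sum_congr rfl fun ν₁ _ => ?_
    rw [Finset.sum_mul, ← Finset.sum_sub_distrib]
    refine Finset.sum_congr rfl fun ν₂ _ => ?_
    simp only [Matrix.cons_val]
    ring
  funext ⟨ν₁, ν₂⟩
  have h2 := sum_symVec_mul_injective (g := fun ν₂ => M (ν₁, ν₂) - N (ν₁, ν₂))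
    fun k l => congrFun (h1 k l) ν₁
  exact sub_eq_zero.mp (congrFun h2 ν₂)

theorem isFusedMatrix_iff_eq {T : Matrix (Fin 4 → Fin 2) (Fin 4 → Fin 2) ℂ}
    {N : Matrix (Fin 3 × Fin 3) (Fin 3 × Fin 3) ℂ} (hN : IsFusedMatrix T N)
    (M : Matrix (Fin 3 × Fin 3) (Fin 3 × Fin 3) ℂ) : IsFusedMatrix T M ↔ M = N := by
  refine ⟨fun hM => ?_, fun h => h ▸ hN⟩
  ext ν μ
  exact congrFun (sum_symVec₂_injective (M := fun ν => M ν μ) (N := fun ν => N ν μ)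
    ((hM μ).symm.trans (hN μ))) ν

theorem IsFusedMatrix.smul {T : Matrix (Fin 4 → Fin 2) (Fin 4 → Fin 2) ℂ}
    {N : Matrix (Fin 3 × Fin 3) (Fin 3 × Fin 3) ℂ} (hN : IsFusedMatrix T N) (c : ℂ) :
    IsFusedMatrix (c • T) (c • N) := by
  intro μ
  rw [Matrix.smul_mulVec, hN μ, Finset.smul_sum]
  exact Finset.sum_congr rfl fun ν _ => by rw [Matrix.smul_apply, smul_assoc]

theorem isFusedMatrix_doubleFusion {a b c d a' b' c' d' e₁ e₂ e₃ e₄ e₁' e₂' e₃' e₄' : ℂ}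
    (h : FusionRelations a b c d a' b' c' d')
    (h' : FusionRelations e₁ e₂ e₃ e₄ e₁' e₂' e₃' e₄')
    (hd : DoubleFusionRelations (fuseWeights a b c d a' b' c' d')
      (fuseWeights e₁ e₂ e₃ e₄ e₁' e₂' e₃' e₄')) :
    IsFusedMatrix
      (onLegs symProj 2 3 * fuseLegs (eightVertex e₁' e₂' e₃' e₄') (eightVertex e₁ e₂ e₃ e₄) 3 *
        fuseLegs (eightVertex a' b' c' d') (eightVertex a b c d) 2)
      (doubleFusion (fuseWeights a b c d a' b' c' d')
        (fuseWeights e₁ e₂ e₃ e₄ e₁' e₂' e₃' e₄')) := by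
  rintro ⟨μ₁, μ₂⟩
  funext s
  obtain ⟨i, j, k, l, rfl⟩ : ∃ i j k l, s = ![i, j, k, l] :=
    ⟨s 0, s 1, s 2, s 3, by ext m; fin_cases m <;> rfl⟩
  rw [fused_mulVec_symVec₂ h h']
  simp only [fusedCoeff_symm hd, Finset.sum_apply, Pi.smul_apply, smul_eq_mul, symVec₂,
    Fintype.sum_prod_type, Finset.mul_sum]
  refine Finset.sum_congr rfl fun ν₁ _ => Finset.sum_congr rfl fun ν₂ _ => ?_
  simp only [Matrix.cons_val]
  ring

/-! ### The two symmetries -/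

theorem finProdFinEquiv_swap_three (i j : Fin 3) :
    (finProdFinEquiv (j, i) : Fin (3 * 3)) =
      (![0, 3, 6, 1, 4, 7, 2, 5, 8] : Fin (3 * 3) → Fin (3 * 3)) (finProdFinEquiv (i, j)) := by
  revert i j; decide

theorem finProdFinEquiv_rev_three (i j : Fin 3) :
    (finProdFinEquiv (i.rev, j.rev) : Fin (3 * 3)) =
      (![8, 7, 6, 5, 4, 3, 2, 1, 0] : Fin (3 * 3) → Fin (3 * 3)) (finProdFinEquiv (i, j)) := by
  revert i j; decide

set_option maxHeartbeats 2000000 in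
theorem nineMatrix_symm (A B C D E F G H J As Bs Cs Gs Hs Js : ℂ) (μ₁ μ₂ ν₁ ν₂ : Fin 3) :
    nineMatrix A B C D E F G H J As Bs Cs Gs Hs Js (ν₁, ν₂) (μ₁, μ₂) =
        nineMatrix A B C D E F G H J As Bs Cs Gs Hs Js (ν₂, ν₁) (μ₂, μ₁) ∧
      nineMatrix A B C D E F G H J As Bs Cs Gs Hs Js (ν₁, ν₂) (μ₁, μ₂) =
        nineMatrix A B C D E F G H J As Bs Cs Gs Hs Js (ν₁.rev, ν₂.rev) (μ₁.rev, μ₂.rev) := by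
  simp only [nineMatrix, Matrix.submatrix_apply, finProdFinEquiv_swap_three ν₁ ν₂,
    finProdFinEquiv_swap_three μ₁ μ₂, finProdFinEquiv_rev_three ν₁ ν₂,
    finProdFinEquiv_rev_three μ₁ μ₂]
  -- Both symmetries are now fixed permutations of nine positions, so row and column may be
  -- arbitrary positions and 81 cases remain.
  generalize (finProdFinEquiv (ν₁, ν₂) : Fin (3 * 3)) = i
  generalize (finProdFinEquiv (μ₁, μ₂) : Fin (3 * 3)) = j
  change Fin 9 at i j
  fin_cases i <;> fin_cases j <;> simp

/-! ## The fused weights in terms of theta functions -/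

/-- The relations between the values `sm, s0, s1` of `ϑ₁` and `tm, t0, t1` of `ϑ₂` at `v-η, v, v+η`
and the values `p, q` at `η`, `p₂, q₂` at `2η`, and `z = ϑ₂(0)`. -/
structure ThetaRelations (p q z p₂ q₂ sm s0 s1 tm t0 t1 : ℂ) : Prop where
  s0_ne : s0 ≠ 0
  t0_ne : t0 ≠ 0
  s1_ne : s1 ≠ 0
  t1_ne : t1 ≠ 0
  mixed : (s1 * tm + sm * t1) * (p * q) = s0 * t0 * (p₂ * z)
  even : q ^ 2 * (tm * t1) + p ^ 2 * (sm * s1) = t0 ^ 2 * q₂ * z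
  odd : q ^ 2 * (sm * s1) + p ^ 2 * (tm * t1) = s0 ^ 2 * q₂ * z

/-- The closed form of the fused weights. -/
noncomputable def thetaWeights (p q z p₂ q₂ sm s0 s1 tm t0 t1 : ℂ) : FusedWeights where
  α := q ^ 2 * tm / (z ^ 2 * t1)
  β := -(s0 ^ 2 * p₂ / (z * t1 * s1))
  γ := -(p ^ 2 * sm / (z ^ 2 * s1))
  αs := q ^ 2 * sm / (z ^ 2 * s1)
  βs := t0 ^ 2 * p₂ / (z * t1 * s1)
  γs := -(p ^ 2 * tm / (z ^ 2 * t1))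
  ε := s0 * t0 * q₂ / (z * t1 * s1)
  φ := p * q * tm / (z ^ 2 * s1)
  ψ := -(p * q * sm / (z ^ 2 * t1))

namespace ThetaRelations

variable {p q z p₂ q₂ sm s0 s1 s2 tm t0 t1 t2 : ℂ}

theorem fusionRelations (h : ThetaRelations p q z p₂ q₂ sm s0 s1 tm t0 t1) (hz : z ≠ 0) :
    FusionRelations (q * tm / (z * t0)) (q * sm / (z * s0)) (p * tm / (z * s0))
      (-(p * sm / (z * t0))) (q * t0 / (z * t1)) (q * s0 / (z * s1)) (p * t0 / (z * s1))
      (-(p * s0 / (z * t1))) := by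
  obtain ⟨h1, h2, h3, h4, hk, he, ho⟩ := h
  constructor
  · field_simp
  · field_simp
  · linear_combination (norm := (field_simp; ring))
      t0 / (z ^ 2 * s0 * s1 * t1) * ho - s0 / (z ^ 2 * t0 * s1 * t1) * he

/-- Only three weights up to starring are sums: `mixed` condenses `β` and `βs`, and `odd` condenses
`ε`. The others are plain cancellations of the values at the middle point. -/
theorem fuseWeights_eq (h : ThetaRelations p q z p₂ q₂ sm s0 s1 tm t0 t1) (hz : z ≠ 0) :
    fuseWeights (q * tm / (z * t0)) (q * sm / (z * s0)) (p * tm / (z * s0))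
      (-(p * sm / (z * t0))) (q * t0 / (z * t1)) (q * s0 / (z * s1)) (p * t0 / (z * s1))
      (-(p * s0 / (z * t1))) = thetaWeights p q z p₂ q₂ sm s0 s1 tm t0 t1 := by
  obtain ⟨h1, h2, h3, h4, hk, he, ho⟩ := h
  rw [fuseWeights, thetaWeights, FusedWeights.mk.injEq]
  refine ⟨?_, ?_, ?_, ?_, ?_, ?_, ?_, ?_, ?_⟩
  · field_simp
  · linear_combination (norm := (field_simp; ring)) -(s0 / (z ^ 2 * t0 * t1 * s1)) * hk
  · field_simp
  · field_simp
  · linear_combination (norm := (field_simp; ring)) t0 / (z ^ 2 * s0 * t1 * s1) * hk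
  · field_simp
  · linear_combination (norm := (field_simp; ring)) t0 / (z ^ 2 * s0 * t1 * s1) * ho
  · field_simp
  · field_simp

/-- Two consecutive triples, centred at `v` and `v+η`, share two points. With denominators cleared,
every relation is a combination of the identities `k0, e0, o0` of the first triple and `k1, e1, o1`
of the second. -/
theorem doubleFusionRelations (h : ThetaRelations p q z p₂ q₂ sm s0 s1 tm t0 t1)
    (h' : ThetaRelations p q z p₂ q₂ s0 s1 s2 t0 t1 t2) (hz : z ≠ 0) :
    DoubleFusionRelations (thetaWeights p q z p₂ q₂ sm s0 s1 tm t0 t1)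
      (thetaWeights p q z p₂ q₂ s0 s1 s2 t0 t1 t2) := by
  obtain ⟨n1, n2, -, -, k0, e0, o0⟩ := h
  obtain ⟨n3, n4, n5, n6, k1, e1, o1⟩ := h'
  constructor <;> dsimp only [thetaWeights]
  · linear_combination (norm := (field_simp; ring))
      -(p * q * s0 / (z ^ 4 * t1 * s1 * s2)) * k0
  · linear_combination (norm := (field_simp; ring))
      -(p * q * t0 / (z ^ 4 * t1 * s1 * t2)) * k0
  · linear_combination (norm := (field_simp; ring))
      p * q * t0 / (z ^ 4 * t1 * s1 * t2) * e0 + t0 ^ 2 * q₂ / (z ^ 3 * s1 * t1 * s2 * t2) * k1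
  · linear_combination (norm := (field_simp; ring))
      -(p * q * s0 / (z ^ 4 * t1 * s1 * s2)) * o0
        - s0 ^ 2 * q₂ / (z ^ 3 * s1 * t1 * s2 * t2) * k1
  · linear_combination (norm := (field_simp; ring))
      s0 / (z ^ 4 * s1 * t1 * s2 * t2 * t0) * (-(s0 * s2 * p * q) * k0 + tm * s1 * q ^ 2 * e1
        + sm * t1 * p ^ 2 * o1 + s1 * t1 * q₂ * z * e0)
  · linear_combination (norm := (field_simp; ring))
      t0 / (z ^ 4 * s1 * t1 * s2 * t2 * s0) * (-(t0 * t2 * p * q) * k0 + sm * t1 * q ^ 2 * o1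
        + tm * s1 * p ^ 2 * e1 + s1 * t1 * q₂ * z * o0)
  · linear_combination (norm := (field_simp; ring)) p₂ / (z ^ 3 * s2 * t2) * e0
  · linear_combination (norm := (field_simp; ring)) -(p₂ / (z ^ 3 * s2 * t2)) * o0
  · linear_combination (norm := (field_simp; ring))
      -(t0 * p * q / (z ^ 4 * s1 * t1 * t2)) * k0
        - t0 * p₂ * s0 / (z ^ 3 * s1 * t1 * s2 * t2) * k1 + p₂ / (z ^ 3 * s2 * t2) * k0
  · linear_combination (norm := (field_simp; ring))
      -(s0 * p * q / (z ^ 4 * s1 * t1 * s2)) * k0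
        - t0 * p₂ * s0 / (z ^ 3 * s1 * t1 * s2 * t2) * k1 + p₂ / (z ^ 3 * s2 * t2) * k0
  · linear_combination (norm := (field_simp; ring)) -(p * q * t0 / (z ^ 4 * s1 * t1 * t2)) * o0
  · linear_combination (norm := (field_simp; ring)) p * q * s0 / (z ^ 4 * s1 * t1 * s2) * e0

end ThetaRelations

/-- After multiplication by `ϑ₂(0)²`, the relations `even` and `odd` follow from the addition
formulas at `(v, η)`, the common factor `ϑ₂(η)⁴ - ϑ₁(η)⁴` being supplied by the formula at `(η, η)`.
-/
theorem thetaRelations {t : ℂ} (ht : 0 < t.im) {v η : ℂ} (h1 : theta1 v t ≠ 0)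
    (h2 : theta2 v t ≠ 0) (h3 : theta1 (v + η) t ≠ 0) (h4 : theta2 (v + η) t ≠ 0) :
    ThetaRelations (theta1 η t) (theta2 η t) (theta2 0 t) (theta1 (2 * η) t) (theta2 (2 * η) t)
      (theta1 (v - η) t) (theta1 v t) (theta1 (v + η) t)
      (theta2 (v - η) t) (theta2 v t) (theta2 (v + η) t) := by
  have hz := pow_ne_zero 2 (theta2_zero_ne_zero ht)
  have e1 := theta1_add_mul_theta1_sub ht v η
  have e2 := theta2_add_mul_theta2_sub ht v η
  have e3 := theta2_add_mul_theta2_sub ht η η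
  rw [← two_mul, sub_self] at e3
  refine ⟨h1, h2, h3, h4, theta1_mul_theta2_add ht v η, mul_right_cancel₀ hz ?_,
    mul_right_cancel₀ hz ?_⟩
  · linear_combination theta2 η t ^ 2 * e2 + theta1 η t ^ 2 * e1 - theta2 v t ^ 2 * e3
  · linear_combination theta2 η t ^ 2 * e1 + theta1 η t ^ 2 * e2 - theta1 v t ^ 2 * e3

theorem fusedR21_eq (τ r : ℂ) (j : Fin 4) (u : ℂ) :
    fusedR21 τ r j u = fusedR21Pref τ r u •
      fuseLegs
        (eightVertex (weightA τ r (u + 1)) (weightB τ r (u + 1)) (weightC τ r (u + 1))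
          (weightD τ r (u + 1)))
        (eightVertex (weightA τ r u) (weightB τ r u) (weightC τ r u) (weightD τ r u)) j := by
  have h (u : ℂ) : baxterR τ r u = baxterR0 τ r u •
      eightVertex (weightA τ r u) (weightB τ r u) (weightC τ r u) (weightD τ r u) := rfl
  rw [fusedR21, h, h, onLegs_smul, onLegs_smul, Matrix.mul_smul, Matrix.mul_smul, Matrix.smul_mul,
    smul_smul, fusedR21Pref, fuseLegs, mul_comm (baxterR0 τ r u)]

theorem doubleFusion_thetaWeights_eq_explicitMatrix {τ r u : ℂ} (hz : theta2 0 (τ / 2) ≠ 0)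
    (h : ThetaRelations (theta1 (1 / (2 * r)) (τ / 2)) (theta2 (1 / (2 * r)) (τ / 2))
      (theta2 0 (τ / 2)) (theta1 (1 / r) (τ / 2)) (theta2 (1 / r) (τ / 2))
      (theta1 ((u - 1) / (2 * r)) (τ / 2)) (theta1 (u / (2 * r)) (τ / 2))
      (theta1 ((u + 1) / (2 * r)) (τ / 2)) (theta2 ((u - 1) / (2 * r)) (τ / 2))
      (theta2 (u / (2 * r)) (τ / 2)) (theta2 ((u + 1) / (2 * r)) (τ / 2)))
    (n1 : theta1 ((u + 2) / (2 * r)) (τ / 2) ≠ 0) (n2 : theta2 ((u + 2) / (2 * r)) (τ / 2) ≠ 0) :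
    doubleFusion
      (thetaWeights (theta1 (1 / (2 * r)) (τ / 2)) (theta2 (1 / (2 * r)) (τ / 2))
        (theta2 0 (τ / 2)) (theta1 (1 / r) (τ / 2)) (theta2 (1 / r) (τ / 2))
        (theta1 ((u - 1) / (2 * r)) (τ / 2)) (theta1 (u / (2 * r)) (τ / 2))
        (theta1 ((u + 1) / (2 * r)) (τ / 2)) (theta2 ((u - 1) / (2 * r)) (τ / 2))
        (theta2 (u / (2 * r)) (τ / 2)) (theta2 ((u + 1) / (2 * r)) (τ / 2)))
      (thetaWeights (theta1 (1 / (2 * r)) (τ / 2)) (theta2 (1 / (2 * r)) (τ / 2))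
        (theta2 0 (τ / 2)) (theta1 (1 / r) (τ / 2)) (theta2 (1 / r) (τ / 2))
        (theta1 (u / (2 * r)) (τ / 2)) (theta1 ((u + 1) / (2 * r)) (τ / 2))
        (theta1 ((u + 2) / (2 * r)) (τ / 2)) (theta2 (u / (2 * r)) (τ / 2))
        (theta2 ((u + 1) / (2 * r)) (τ / 2)) (theta2 ((u + 2) / (2 * r)) (τ / 2))) =
      explicitMatrix τ r u := by
  obtain ⟨m1, m2, m3, m4, k, -, -⟩ := h
  simp only [doubleFusion, thetaWeights, explicitMatrix, entryA, entryB, entryC,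
    entryD, entryE, entryF, entryG, entryH, entryI, Pi.neg_apply]
  generalize theta1 (1 / (2 * r)) (τ / 2) = p at *
  generalize theta2 (1 / (2 * r)) (τ / 2) = q at *
  generalize theta2 0 (τ / 2) = z at *
  generalize theta1 (1 / r) (τ / 2) = p2 at *
  generalize theta2 (1 / r) (τ / 2) = q2 at *
  generalize theta1 ((u - 1) / (2 * r)) (τ / 2) = sm at *
  generalize theta1 (u / (2 * r)) (τ / 2) = s0 at *
  generalize theta1 ((u + 1) / (2 * r)) (τ / 2) = s1 at *
  generalize theta1 ((u + 2) / (2 * r)) (τ / 2) = s2 at *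
  generalize theta2 ((u - 1) / (2 * r)) (τ / 2) = tm at *
  generalize theta2 (u / (2 * r)) (τ / 2) = t0 at *
  generalize theta2 ((u + 1) / (2 * r)) (τ / 2) = t1 at *
  generalize theta2 ((u + 2) / (2 * r)) (τ / 2) = t2 at *
  change nineMatrix _ _ _ _ _ _ _ _ _ _ _ _ _ _ _ = nineMatrix _ _ _ _ _ _ _ _ _ _ _ _ _ _ _
  congr 1
  -- Only `D` is a sum that must be condensed by a theta identity, the relation `mixed`; the other
  -- entries match after clearing denominators.
  case e_D => linear_combination (norm := (field_simp; ring)) -(p2 / (z ^ 3 * s2 * t2)) * k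
  all_goals field_simp
  all_goals try ring

/-! ## The main theorem -/

theorem mainTheorem4 (τ r : ℂ) (hτ : 0 < τ.im) (hr : 0 < (τ * r).im) (u : ℂ)
    (hu_minus : BaxterRegular τ r (u - 1)) (hu : BaxterRegular τ r u)
    (hu_plus : BaxterRegular τ r (u + 1)) :
    (bracket τ r (u - 1) ≠ 0 ∧
      fusedR22Pref τ r u = bracket τ r (u + 1) / bracket τ r (u - 1)) ∧
    (∀ M : Matrix (Fin 3 × Fin 3) (Fin 3 × Fin 3) ℂ,
      IsFusedMatrix (fusedR22 τ r u) M ↔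
        M = (bracket τ r (u + 1) / bracket τ r (u - 1)) • explicitMatrix τ r u) ∧
    (∀ M : Matrix (Fin 3 × Fin 3) (Fin 3 × Fin 3) ℂ, IsFusedMatrix (fusedR22 τ r u) M →
      (∀ μ₁ μ₂ ν₁ ν₂ : Fin 3, M (ν₁, ν₂) (μ₁, μ₂) = M (ν₂, ν₁) (μ₂, μ₁)) ∧
      (∀ μ₁ μ₂ ν₁ ν₂ : Fin 3,
        M (ν₁, ν₂) (μ₁, μ₂) = M (ν₁.rev, ν₂.rev) (μ₁.rev, μ₂.rev))) := by
  have hpref := fusedR22Pref_eq hτ hr hu_minus.1 hu.1 hu_plus.1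
  have hr0 : r ≠ 0 := by
    rintro rfl
    simp at hr
  have ht : 0 < (τ / 2).im := by
    simpa using hτ
  have hz := theta2_zero_ne_zero ht
  obtain ⟨-, m1, m2⟩ := hu_minus
  obtain ⟨-, m3, m4⟩ := hu
  obtain ⟨-, m5, m6⟩ := hu_plus
  rw [add_sub_cancel] at m1 m2
  rw [add_comm 1 u] at m3 m4
  rw [show 1 + (u + 1) = u + 2 by ring] at m5 m6
  have a1 : u / (2 * r) + 1 / (2 * r) = (u + 1) / (2 * r) := by ring
  have a2 : (u + 1) / (2 * r) + 1 / (2 * r) = (u + 2) / (2 * r) := by ring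
  have a3 : u / (2 * r) - 1 / (2 * r) = (u - 1) / (2 * r) := by ring
  have a4 : (u + 1) / (2 * r) - 1 / (2 * r) = u / (2 * r) := by ring
  have a5 : 2 * (1 / (2 * r)) = 1 / r := by field_simp
  -- The right-hand fused operator, at `u-1`, involves the arguments `u-1, u, u+1` over `2r`; the
  -- left-hand one, at `u`, involves `u, u+1, u+2`. So the two triples are centred at `u` and `u+1`.
  have R0 := thetaRelations ht (v := u / (2 * r)) (η := 1 / (2 * r)) m1 m2
    (by rwa [a1]) (by rwa [a1])
  have R1 := thetaRelations ht (v := (u + 1) / (2 * r)) (η := 1 / (2 * r)) m3 m4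
    (by rwa [a2]) (by rwa [a2])
  rw [a1, a3, a5] at R0
  rw [a2, a4, a5] at R1
  have hfused : IsFusedMatrix (fusedR22 τ r u)
      ((bracket τ r (u + 1) / bracket τ r (u - 1)) • explicitMatrix τ r u) := by
    have F0 := R0.fusionRelations hz
    have F1 := R1.fusionRelations hz
    have hD := R0.doubleFusionRelations R1 hz
    rw [← R0.fuseWeights_eq hz, ← R1.fuseWeights_eq hz] at hD
    have key := isFusedMatrix_doubleFusion F0 F1 hD
    rw [R0.fuseWeights_eq hz, R1.fuseWeights_eq hz,
      doubleFusion_thetaWeights_eq_explicitMatrix hz R0 m5 m6] at key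
    rw [← hpref.2]
    convert key.smul (fusedR22Pref τ r u) using 1
    rw [fusedR22, fusedR21_eq, fusedR21_eq, Matrix.mul_smul, Matrix.mul_smul, Matrix.smul_mul,
      smul_smul, fusedR22Pref, sub_add_cancel]
    simp only [weightA, weightB, weightC, weightD, add_sub_cancel, add_comm 1 u,
      show 1 + (u + 1) = u + 2 by ring]
  have hiff := isFusedMatrix_iff_eq hfused
  refine ⟨hpref, hiff, fun M hM => ?_⟩
  rw [hiff] at hM
  subst hM
  have hsymm (μ₁ μ₂ ν₁ ν₂ : Fin 3) :
      explicitMatrix τ r u (ν₁, ν₂) (μ₁, μ₂) = explicitMatrix τ r u (ν₂, ν₁) (μ₂, μ₁) ∧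
        explicitMatrix τ r u (ν₁, ν₂) (μ₁, μ₂) =
          explicitMatrix τ r u (ν₁.rev, ν₂.rev) (μ₁.rev, μ₂.rev) :=
    nineMatrix_symm _ _ _ _ _ _ _ _ _ _ _ _ _ _ _ μ₁ μ₂ ν₁ ν₂
  simp only [Matrix.smul_apply]
  exact ⟨fun μ₁ μ₂ ν₁ ν₂ => congrArg _ (hsymm μ₁ μ₂ ν₁ ν₂).1,
    fun μ₁ μ₂ ν₁ ν₂ => congrArg _ (hsymm μ₁ μ₂ ν₁ ν₂).2⟩
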